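/- Let $p\ge 1$ be an integer, $q=e^{2\pi i/p}$, $R=\mathbb C[z,z^{-1}]$, and let $\sigma$ be the $\mathbb C$-algebra automorphism of $R$ with $\sigma(z)=q^{-1}z$. Let $A(1)$ be the generalized Weyl algebra generated by $R$, $X$, $Y$ with $Xr=\sigma(r)X$, $Yr=\sigma^{-1}(r)Y$ for $r\in R$ and $XY=YX=1$; it is the skew Laurent polynomial ring $R[X,X^{-1};\sigma]$. Let $\omega=\{(z-q^k)\mid 0\le k<p\}$ be the $\sigma$-orbit of the maximal ideal $(z-1)$ of $R$. Consider the left $A(1)$-modules $M$ such that $M=\bigoplus_{\mathfrak m\in\operatorname{MaxSpec}R}M_{\mathfrak m}$ with $M_{\mathfrak m}=\{v\in M\mid \mathfrak m v=0\}$, every $M_{\mathfrak m}$ is finite dimensional over $R/\mathfrak m$, and $M_{\mathfrak m}=0$ unless $\mathfrak m\in\omega$. Let $\mathscr A^{\mathrm{split}}(\omega,\{1\})=\mathbb C\otimes_{\mathbb Z}K_0^{\mathrm{split}}$ be the complexified split Grothendieck group of these modules (so $[M\oplus N]=[M]+[N]$), made into a commutative $\mathbb C$-algebra by $[M][N]=[M\otimes_R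 N]$, where $X$ and $Y$ act on $M\otimes_R N$ by $X(v\otimes w)=Xv\otimes Xw$ and $Y(v\otimes w)=Yv\otimes Yw$. For $\xi\in\mathbb C^\times$ and $a\ge1$ let $u(\xi,a)$ be the class of the module with basis $e_{k,s}$ ($1\le k\le p$, $1\le s\le a$) on which $z e_{k,s}=q^k e_{k,s}$, $Xe_{k,s}=e_{k+1,s}$ for $k<p$, $Xe_{p,s}=\sum_{s'}F_{s's}e_{1,s'}$, and $Y$ acts by the inverse of $X$; here $F$ is the companion matrix of $(x-\xi)^a$. Then $\mathscr A^{\mathrm{split}}(\omega,\{1\})$ is generated as a $\mathbb C$-algebra by the elements $u(\xi,1)$, $\xi\in\mathbb C^\times$, together with $u(1,2)$, and as a commutative unital $\mathbb C$-algebra on these generators it is presented by the relations $$u(\xi,1)\,u(\eta,1)=u(\xi\eta,1)\quad(\xi,\eta\in\mathbb C^\times),\qquad u(1,1)=1 .$$ Equivalently, there is an isomorphism of $\mathbb C$-algebras from the polynomial ring $\mathbb C[\mathbb C^\times][x]$ in one variable over the group algebra of $\mathbb C^\times$ to $\mathscr A^{\mathrm{split}}(\omega,\{1\})$ that sends the group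 element $\xi$ to $u(\xi,1)$ and $x$ to $u(1,2)$. -/

import Mathlib

noncomputable section

open Submodule TensorProduct

universe u

/-! ### Generalized Weyl algebras of rank one -/

/-- Symbols generating a generalized Weyl algebra: one for each element of the
base ring, together with `X` and `Y`. -/
inductive GWAGen (R : Type u) : Type u
  | coeff (r : R)
  | X
  | Y

/-- The defining relations of the generalized Weyl algebra `A(R, σ, t)`. The first three say that
the base ring maps to it by a ring homomorphism. -/
inductive GWARel {R : Type u} [CommRing R] (σ : RingAut R) (t : R) :
    FreeAlgebra ℤ (GWAGen R) → FreeAlgebra ℤ (GWAGen R) → Prop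
  | add (r s : R) : GWARel σ t (FreeAlgebra.ι ℤ (.coeff (r + s)))
      (FreeAlgebra.ι ℤ (.coeff r) + FreeAlgebra.ι ℤ (.coeff s))
  | mul (r s : R) : GWARel σ t (FreeAlgebra.ι ℤ (.coeff (r * s)))
      (FreeAlgebra.ι ℤ (.coeff r) * FreeAlgebra.ι ℤ (.coeff s))
  | one : GWARel σ t (FreeAlgebra.ι ℤ (.coeff 1)) 1
  | X_coeff (r : R) : GWARel σ t (FreeAlgebra.ι ℤ .X * FreeAlgebra.ι ℤ (.coeff r))
      (FreeAlgebra.ι ℤ (.coeff (σ r)) * FreeAlgebra.ι ℤ .X)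
  | Y_coeff (r : R) : GWARel σ t (FreeAlgebra.ι ℤ .Y * FreeAlgebra.ι ℤ (.coeff r))
      (FreeAlgebra.ι ℤ (.coeff (σ.symm r)) * FreeAlgebra.ι ℤ .Y)
  | Y_X : GWARel σ t (FreeAlgebra.ι ℤ .Y * FreeAlgebra.ι ℤ .X) (FreeAlgebra.ι ℤ (.coeff t))
  | X_Y : GWARel σ t (FreeAlgebra.ι ℤ .X * FreeAlgebra.ι ℤ .Y) (FreeAlgebra.ι ℤ (.coeff (σ t)))

/-- The generalized Weyl algebra `A(R, σ, t)`. -/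
def GWA {R : Type u} [CommRing R] (σ : RingAut R) (t : R) : Type u :=
  RingQuot (GWARel σ t)

namespace GWA

variable {R : Type u} [CommRing R] (σ : RingAut R) (t : R)

instance : Ring (GWA σ t) := inferInstanceAs (Ring (RingQuot (GWARel σ t)))

/-- The canonical map from the free ring. -/
def mk : FreeAlgebra ℤ (GWAGen R) →+* GWA σ t := RingQuot.mkRingHom (GWARel σ t)

variable {σ t} in
theorem mk_rel {a b : FreeAlgebra ℤ (GWAGen R)} (h : GWARel σ t a b) : mk σ t a = mk σ t b :=
  RingQuot.mkRingHom_rel h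

theorem mk_surjective : Function.Surjective (mk σ t) := RingQuot.mkRingHom_surjective _

/-- The base ring maps to the generalized Weyl algebra. -/
def coeff : R →+* GWA σ t where
  toFun r := mk σ t (FreeAlgebra.ι ℤ (.coeff r))
  map_one' := by rw [mk_rel .one, map_one]
  map_mul' r s := by rw [mk_rel (.mul r s), map_mul]
  map_add' r s := by rw [mk_rel (.add r s), map_add]
  map_zero' := by
    have h := mk_rel (σ := σ) (t := t) (.add 0 0)
    rw [map_add, add_zero] at h
    exact left_eq_add.mp h

/-- The generator `X`. -/
def X : GWA σ t := mk σ t (FreeAlgebra.ι ℤ .X)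

/-- The generator `Y`. -/
def Y : GWA σ t := mk σ t (FreeAlgebra.ι ℤ .Y)

theorem X_mul_coeff (r : R) : X σ t * coeff σ t r = coeff σ t (σ r) * X σ t := by
  have := mk_rel (σ := σ) (t := t) (.X_coeff r)
  rwa [map_mul, map_mul] at this

theorem Y_mul_coeff (r : R) : Y σ t * coeff σ t r = coeff σ t (σ.symm r) * Y σ t := by
  have := mk_rel (σ := σ) (t := t) (.Y_coeff r)
  rwa [map_mul, map_mul] at this

theorem Y_mul_X : Y σ t * X σ t = coeff σ t t := by
  have := mk_rel (σ := σ) (t := t) .Y_X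
  rwa [map_mul] at this

theorem X_mul_Y : X σ t * Y σ t = coeff σ t (σ t) := by
  have := mk_rel (σ := σ) (t := t) .X_Y
  rwa [map_mul] at this

variable {σ t} in
/-- The generalized Weyl algebra is generated by the base ring, `X` and `Y`. -/
theorem induction {P : GWA σ t → Prop} (coeff : ∀ r, P (coeff σ t r)) (X : P (X σ t))
    (Y : P (Y σ t)) (add : ∀ a b, P a → P b → P (a + b)) (mul : ∀ a b, P a → P b → P (a * b))
    (a : GWA σ t) : P a := by
  obtain ⟨a, rfl⟩ := mk_surjective σ t a
  induction a using FreeAlgebra.induction with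
  | grade0 n =>
    have h : mk σ t (algebraMap ℤ _ n) = GWA.coeff σ t (n : R) := by simp
    rw [h]; exact coeff _
  | grade1 g => cases g with
    | coeff r => exact coeff r
    | X => exact X
    | Y => exact Y
  | mul a b ha hb => rw [map_mul]; exact mul _ _ ha hb
  | add a b ha hb => rw [map_add]; exact add _ _ ha hb

section lift

variable {σ t}
variable {S : Type*} [Ring S] (f : R →+* S) (x y : S)
  (hx : ∀ r, x * f r = f (σ r) * x) (hy : ∀ r, y * f r = f (σ.symm r) * y)
  (hyx : y * x = f t) (hxy : x * y = f (σ t))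

/-- The values of a ring homomorphism on the generators. -/
def genMap : GWAGen R → S
  | .coeff r => f r
  | .X => x
  | .Y => y

theorem genMap_rel (hx : ∀ r, x * f r = f (σ r) * x) (hy : ∀ r, y * f r = f (σ.symm r) * y)
    (hyx : y * x = f t) (hxy : x * y = f (σ t)) ⦃a b : FreeAlgebra ℤ (GWAGen R)⦄ (h : GWARel σ t a b) :
    (FreeAlgebra.lift ℤ (genMap f x y) : _ →+* S) a =
      (FreeAlgebra.lift ℤ (genMap f x y) : _ →+* S) b := by
  cases h <;> simp [genMap, hx, hy, hyx, hxy]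

/-- The universal property of the generalized Weyl algebra. -/
def lift : GWA σ t →+* S :=
  RingQuot.lift ⟨(FreeAlgebra.lift ℤ (genMap f x y) : _ →+* S), genMap_rel f x y hx hy hyx hxy⟩

theorem lift_mk (a : FreeAlgebra ℤ (GWAGen R)) :
    lift f x y hx hy hyx hxy (mk σ t a) = FreeAlgebra.lift ℤ (genMap f x y) a :=
  RingQuot.lift_mkRingHom_apply _ _ _

theorem lift_coeff (r : R) : lift f x y hx hy hyx hxy (coeff σ t r) = f r := by
  refine (lift_mk ..).trans ?_; simp [genMap]

theorem lift_X : lift f x y hx hy hyx hxy (X σ t) = x := by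
  refine (lift_mk ..).trans ?_; simp [genMap]

theorem lift_Y : lift f x y hx hy hyx hxy (Y σ t) = y := by
  refine (lift_mk ..).trans ?_; simp [genMap]

end lift

section module

variable {σ t}
variable {M : Type*} [AddCommGroup M] [Module R M] (x y : M →+ M)
  (hx : ∀ r v, x (r • v) = σ r • x v) (hy : ∀ r v, y (r • v) = σ.symm r • y v)
  (hyx : ∀ v, y (x v) = t • v) (hxy : ∀ v, x (y v) = σ t • v)

/-- Semilinear maps `x`, `y` on an `R`-module satisfying the defining relations make it a module
over the generalized Weyl algebra. -/
abbrev moduleOf : Module (GWA σ t) M :=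
  Module.compHom M
    (lift (S := AddMonoid.End M) (Module.toAddMonoidEnd R M) x y
      (fun r ↦ AddMonoidHom.ext (hx r)) (fun r ↦ AddMonoidHom.ext (hy r))
      (AddMonoidHom.ext hyx) (AddMonoidHom.ext hxy) : GWA σ t →+* AddMonoid.End M)

theorem moduleOf_coeff (r : R) (v : M) :
    letI := moduleOf x y hx hy hyx hxy; coeff σ t r • v = r • v :=
  DFunLike.congr_fun (lift_coeff (S := AddMonoid.End M) ..) v

theorem moduleOf_X (v : M) : letI := moduleOf x y hx hy hyx hxy; X σ t • v = x v :=
  DFunLike.congr_fun (lift_X (S := AddMonoid.End M) ..) v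

theorem moduleOf_Y (v : M) : letI := moduleOf x y hx hy hyx hxy; Y σ t • v = y v :=
  DFunLike.congr_fun (lift_Y (S := AddMonoid.End M) ..) v

end module

end GWA

/-! ### Weight modules supported on a finite orbit -/

/-- A finite orbit, with a chosen point, of the cyclic group generated by `σ` in the maximal
spectrum of `R`. -/
structure FiniteOrbit {R : Type u} [CommRing R] (σ : RingAut R) where
  carrier : Set (MaximalSpectrum R)
  base : MaximalSpectrum R
  mem_iff : ∀ m, m ∈ carrier ↔ ∃ i : ℤ, m.asIdeal = base.asIdeal.map (σ ^ i : RingAut R)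
  finite : carrier.Finite

/-- The weight space `M_𝔪 = {v ∈ M | 𝔪 v = 0}`. -/
abbrev weightSpace {R : Type u} [CommRing R] (M : Type u) [AddCommGroup M] [Module R M]
    (m : MaximalSpectrum R) : Submodule R M :=
  torsionBySet R M (m.asIdeal : Set R)

open Classical in
/-- `M` is the direct sum of its weight spaces, these are finite dimensional over the residue
fields, and all `𝔪` with `M_𝔪 ≠ 0` lie in `ω`. -/
structure IsWeight {R : Type u} [CommRing R] (ω : Set (MaximalSpectrum R))
    (M : Type u) [AddCommGroup M] [Module R M] : Prop where
  isInternal : DirectSum.IsInternal fun m : MaximalSpectrum R ↦ weightSpace M m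
  finite : ∀ m : MaximalSpectrum R, Module.Finite (R ⧸ m.asIdeal) (weightSpace M m)
  support : ∀ m : MaximalSpectrum R, weightSpace M m ≠ ⊥ → m ∈ ω

section IsWeight

variable {R : Type u} [CommRing R] {ω : Set (MaximalSpectrum R)}
  {M : Type u} [AddCommGroup M] [Module R M]

/-- The intersection of the maximal ideals in `ω`. -/
def idealOf (ω : Set (MaximalSpectrum R)) : Ideal R := ⨅ m ∈ ω, m.asIdeal

theorem mem_idealOf {r : R} : r ∈ idealOf ω ↔ ∀ m ∈ ω, r ∈ m.asIdeal := by
  simp [idealOf]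

theorem IsWeight.smul_eq_zero (h : IsWeight ω M) {r : R} (hr : r ∈ idealOf ω) (v : M) :
    r • v = 0 := by
  classical
  have htop : (⊤ : Submodule R M) ≤ torsionBySet R M (idealOf ω : Set R) := by
    rw [← h.isInternal.submodule_iSup_eq_top]
    refine iSup_le fun m ↦ ?_
    by_cases hm : weightSpace M m = ⊥
    · rw [hm]; exact bot_le
    · exact torsionBySet_le_torsionBySet_of_subset fun r hr ↦
        mem_idealOf.1 hr m (h.support m hm)
  exact (mem_torsionBySet_iff _ _).1 (htop (mem_top (x := v))) ⟨r, hr⟩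

theorem IsWeight.moduleFinite (h : IsWeight ω M) (hω : ω.Finite) : Module.Finite R M := by
  classical
  have htop : (⊤ : Submodule R M) = ⨆ m ∈ hω.toFinset, weightSpace M m := by
    rw [← h.isInternal.submodule_iSup_eq_top]
    refine le_antisymm (iSup_le fun m ↦ ?_) (iSup_le fun m ↦ iSup_le fun _ ↦ le_iSup _ m)
    by_cases hm : weightSpace M m = ⊥
    · rw [hm]; exact bot_le
    · exact le_biSup (fun m ↦ weightSpace M m) (hω.mem_toFinset.2 (h.support m hm))
  refine ⟨htop ▸ Submodule.fg_biSup _ _ fun m _ ↦ ?_⟩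
  have := h.finite m
  have : Module.Finite R (weightSpace M m) := Module.Finite.trans (R ⧸ m.asIdeal) _
  exact (Module.Finite.iff_fg).1 this

theorem sup_eq_top_of_ne {m n : MaximalSpectrum R} (h : m ≠ n) : m.asIdeal ⊔ n.asIdeal = ⊤ :=
  Ideal.IsMaximal.coprime_of_ne m.isMaximal n.isMaximal fun e ↦ h (MaximalSpectrum.ext e)

theorem isWeight_of (hω : ω.Finite) (h : ∀ r ∈ idealOf ω, ∀ v : M, r • v = 0)
    [Module.Finite R M] : IsWeight ω M := by
  classical
  have hind : iSupIndep fun m : MaximalSpectrum R ↦ weightSpace M m :=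
    iSupIndep_iff_supIndep.2 fun s ↦
      supIndep_torsionBySet_ideal (p := fun m : MaximalSpectrum R ↦ m.asIdeal)
        fun m _ n _ hmn ↦ sup_eq_top_of_ne hmn
  have htop' : ⨆ m ∈ hω.toFinset, weightSpace M m = ⊤ := by
    refine (iSup_torsionBySet_ideal_eq_torsionBySet_iInf
      (p := fun m : MaximalSpectrum R ↦ m.asIdeal)
      fun m _ n _ hmn ↦ sup_eq_top_of_ne hmn).trans ?_
    refine eq_top_iff.2 fun v _ ↦ (mem_torsionBySet_iff _ _).2 fun r ↦ h r ?_ v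
    have := r.2
    simpa [mem_idealOf] using this
  have htop : ⨆ m : MaximalSpectrum R, weightSpace M m = ⊤ :=
    eq_top_iff.2 (htop' ▸ iSup_le fun m ↦ iSup_le fun _ ↦ le_iSup (fun m ↦ weightSpace M m) m)
  refine ⟨DirectSum.isInternal_submodule_of_iSupIndep_of_iSup_eq_top hind htop, fun m ↦ ?_,
    fun m hm ↦ ?_⟩
  · have hc : IsCompl (⨆ (n) (_ : n ≠ m), weightSpace M n) (weightSpace M m) := by
      refine ⟨(hind m).symm, codisjoint_iff.2 (eq_top_iff.2 (htop ▸ iSup_le fun n ↦ ?_))⟩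
      by_cases hn : n = m
      · subst hn; exact le_sup_right
      · exact (le_biSup (fun n ↦ weightSpace M n) hn).trans le_sup_left
    have : Module.Finite R (weightSpace M m) :=
      Module.Finite.equiv (quotientEquivOfIsCompl _ _ hc)
    exact Module.Finite.of_restrictScalars_finite R (R ⧸ m.asIdeal) _
  · by_contra hmω
    refine hm (eq_bot_iff.2 ?_)
    have hd := hind m
    refine hd le_rfl ?_
    refine le_top.trans (htop'.symm.le.trans (iSup_le fun n ↦ iSup_le fun hn ↦ ?_))
    exact le_biSup (fun n ↦ weightSpace M n)
      (fun e ↦ hmω (e ▸ hω.mem_toFinset.1 hn) : n ≠ m)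

end IsWeight

/-- The objects of the category of weight modules over the generalized Weyl algebra `A(R, σ, t)`
with finite dimensional weight spaces and with support in `ω`. -/
structure WeightModule {R : Type u} [CommRing R] (σ : RingAut R) (t : R)
    (ω : Set (MaximalSpectrum R)) : Type (u + 1) where
  carrier : Type u
  [addCommGroup : AddCommGroup carrier]
  [moduleBase : Module R carrier]
  [module : Module (GWA σ t) carrier]
  /-- The `R`-module structure is the restriction of the module structure. -/
  coeff_smul : ∀ (r : R) (v : carrier), GWA.coeff σ t r • v = r • v
  isWeight : IsWeight ω carrier

namespace WeightModule

variable {R : Type u} [CommRing R] {σ : RingAut R}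

attribute [instance] addCommGroup moduleBase module

section basic

variable {t : R} {ω : Set (MaximalSpectrum R)}

theorem X_smul_smul (M : WeightModule σ t ω) (r : R) (v : M.carrier) :
    GWA.X σ t • r • v = σ r • GWA.X σ t • v := by
  rw [← M.coeff_smul, ← M.coeff_smul, ← mul_smul, ← mul_smul, GWA.X_mul_coeff]

theorem Y_smul_smul (M : WeightModule σ t ω) (r : R) (v : M.carrier) :
    GWA.Y σ t • r • v = σ.symm r • GWA.Y σ t • v := by
  rw [← M.coeff_smul, ← M.coeff_smul, ← mul_smul, ← mul_smul, GWA.Y_mul_coeff]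

theorem Y_smul_X_smul (M : WeightModule σ t ω) (v : M.carrier) :
    GWA.Y σ t • GWA.X σ t • v = t • v := by
  rw [← M.coeff_smul, ← mul_smul, GWA.Y_mul_X]

theorem X_smul_Y_smul (M : WeightModule σ t ω) (v : M.carrier) :
    GWA.X σ t • GWA.Y σ t • v = σ t • v := by
  rw [← M.coeff_smul, ← mul_smul, GWA.X_mul_Y]

/-- Semilinear maps `x`, `y` on a suitable `R`-module define a weight module. -/
@[simps carrier]
def of (M : Type u) [AddCommGroup M] [Module R M] (x y : M →+ M)
    (hx : ∀ r v, x (r • v) = σ r • x v) (hy : ∀ r v, y (r • v) = σ.symm r • y v)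
    (hyx : ∀ v, y (x v) = t • v) (hxy : ∀ v, x (y v) = σ t • v) (h : IsWeight ω M) :
    WeightModule σ t ω :=
  letI := GWA.moduleOf x y hx hy hyx hxy
  { carrier := M
    coeff_smul := GWA.moduleOf_coeff x y hx hy hyx hxy
    isWeight := h }

theorem of_X_smul (M : Type u) [AddCommGroup M] [Module R M] (x y : M →+ M)
    (hx : ∀ r v, x (r • v) = σ r • x v) (hy : ∀ r v, y (r • v) = σ.symm r • y v)
    (hyx : ∀ v, y (x v) = t • v) (hxy : ∀ v, x (y v) = σ t • v) (h : IsWeight ω M)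
    (v : (of M x y hx hy hyx hxy h).carrier) : GWA.X σ t • v = (x (v : M) : M) :=
  GWA.moduleOf_X (M := M) x y hx hy hyx hxy v

theorem of_Y_smul (M : Type u) [AddCommGroup M] [Module R M] (x y : M →+ M)
    (hx : ∀ r v, x (r • v) = σ r • x v) (hy : ∀ r v, y (r • v) = σ.symm r • y v)
    (hyx : ∀ v, y (x v) = t • v) (hxy : ∀ v, x (y v) = σ t • v) (h : IsWeight ω M)
    (v : (of M x y hx hy hyx hxy h).carrier) : GWA.Y σ t • v = (y (v : M) : M) :=
  GWA.moduleOf_Y (M := M) x y hx hy hyx hxy v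

/-- Isomorphism of weight modules: a bijective `A(R, σ, t)`-linear map. -/
def Iso (M N : WeightModule σ t ω) : Prop := Nonempty (M.carrier ≃ₗ[GWA σ t] N.carrier)

/-- A bijective additive map compatible with `R`, `X` and `Y` is an isomorphism. -/
theorem Iso.of_addEquiv {M N : WeightModule σ t ω} (e : M.carrier ≃+ N.carrier)
    (hr : ∀ (r : R) v, e (r • v) = r • e v) (hX : ∀ v, e (GWA.X σ t • v) = GWA.X σ t • e v)
    (hY : ∀ v, e (GWA.Y σ t • v) = GWA.Y σ t • e v) : Iso M N := by
  refine ⟨{ e with map_smul' := fun a v ↦ ?_ }⟩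
  change e (a • v) = a • e v
  induction a using GWA.induction generalizing v with
  | coeff r => rw [M.coeff_smul, N.coeff_smul, hr]
  | X => exact hX v
  | Y => exact hY v
  | add a b ha hb => rw [add_smul, add_smul, map_add, ha, hb]
  | mul a b ha hb => rw [mul_smul, mul_smul, ha, hb]

/-- An isomorphism is `R`-linear. -/
theorem equiv_smul {M N : WeightModule σ t ω} (e : M.carrier ≃ₗ[GWA σ t] N.carrier) (r : R)
    (v : M.carrier) : e (r • v) = r • e v := by
  rw [← M.coeff_smul, ← N.coeff_smul, map_smul]

instance setoid (σ : RingAut R) (t : R) (ω : Set (MaximalSpectrum R)) :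
    Setoid (WeightModule σ t ω) where
  r := Iso
  iseqv := ⟨fun _ ↦ ⟨.refl _ _⟩, fun ⟨e⟩ ↦ ⟨e.symm⟩, fun ⟨e⟩ ⟨f⟩ ↦ ⟨e.trans f⟩⟩

end basic

section operations

variable {ω : FiniteOrbit σ} {t s r : R}

/-- The direct sum of two weight modules. -/
def directSum (M N : WeightModule σ t ω.carrier) : WeightModule σ t ω.carrier where
  carrier := M.carrier × N.carrier
  coeff_smul r v := Prod.ext (M.coeff_smul r v.1) (N.coeff_smul r v.2)
  isWeight := by
    have := M.isWeight.moduleFinite ω.finite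
    have := N.isWeight.moduleFinite ω.finite
    exact isWeight_of ω.finite fun r hr v ↦
      Prod.ext (M.isWeight.smul_eq_zero hr v.1) (N.isWeight.smul_eq_zero hr v.2)

/-- The zero module. -/
def zero (σ : RingAut R) (t : R) (ω : FiniteOrbit σ) : WeightModule σ t ω.carrier where
  carrier := PUnit
  coeff_smul _ _ := rfl
  isWeight := isWeight_of ω.finite fun _ _ _ ↦ rfl

/-- For additive maps `f` and `g` that are semilinear with respect to the same automorphism,
the additive map `v ⊗ w ↦ f v ⊗ g w`. -/
def diagonal {M N : Type u} [AddCommGroup M] [Module R M] [AddCommGroup N] [Module R N]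
    (τ : RingAut R) (f : M →+ M) (g : N →+ N) (hf : ∀ (r : R) v, f (r • v) = τ r • f v)
    (hg : ∀ (r : R) v, g (r • v) = τ r • g v) : M ⊗[R] N →+ M ⊗[R] N :=
  TensorProduct.liftAddHom
    (AddMonoidHom.mk' (fun v ↦ AddMonoidHom.mk' (fun w ↦ f v ⊗ₜ[R] g w)
      fun _ _ ↦ by rw [map_add, tmul_add])
      fun _ _ ↦ AddMonoidHom.ext fun _ ↦ by simp [add_tmul])
    fun r v w ↦ by simp [hf, hg, smul_tmul]

theorem diagonal_tmul {M N : Type u} [AddCommGroup M] [Module R M] [AddCommGroup N] [Module R N]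
    (τ : RingAut R) (f : M →+ M) (g : N →+ N) (hf : ∀ (r : R) v, f (r • v) = τ r • f v)
    (hg : ∀ (r : R) v, g (r • v) = τ r • g v) (v : M) (w : N) :
    diagonal τ f g hf hg (v ⊗ₜ w) = f v ⊗ₜ g w := rfl

theorem diagonal_smul {M N : Type u} [AddCommGroup M] [Module R M] [AddCommGroup N] [Module R N]
    (τ : RingAut R) (f : M →+ M) (g : N →+ N) (hf : ∀ (r : R) v, f (r • v) = τ r • f v)
    (hg : ∀ (r : R) v, g (r • v) = τ r • g v) (r : R) (v : M ⊗[R] N) :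
    diagonal τ f g hf hg (r • v) = τ r • diagonal τ f g hf hg v := by
  induction v using TensorProduct.induction_on with
  | zero => simp
  | tmul v w => rw [smul_tmul', diagonal_tmul, diagonal_tmul, hf, smul_tmul']
  | add v w hv hw => rw [smul_add, map_add, hv, hw, map_add, smul_add]

/-- The action of `X` as an additive map. -/
def actX (M : WeightModule σ t ω.carrier) : M.carrier →+ M.carrier :=
  DistribSMul.toAddMonoidHom _ (GWA.X σ t)

/-- The action of `Y` as an additive map. -/
def actY (M : WeightModule σ t ω.carrier) : M.carrier →+ M.carrier :=
  DistribSMul.toAddMonoidHom _ (GWA.Y σ t)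

theorem actX_smul (M : WeightModule σ t ω.carrier) (r : R) (v : M.carrier) :
    M.actX (r • v) = σ r • M.actX v := M.X_smul_smul r v

theorem actY_smul (M : WeightModule σ t ω.carrier) (r : R) (v : M.carrier) :
    M.actY (r • v) = σ.symm r • M.actY v := M.Y_smul_smul r v

theorem actY_actX (M : WeightModule σ t ω.carrier) (v : M.carrier) :
    M.actY (M.actX v) = t • v := M.Y_smul_X_smul v

theorem actX_actY (M : WeightModule σ t ω.carrier) (v : M.carrier) :
    M.actX (M.actY v) = σ t • v := M.X_smul_Y_smul v

/-- The tensor product over `R` of a weight module over `A(R, σ, t)` and a weight module over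
`A(R, σ, s)`. It is a weight module over `A(R, σ, t s)`, on which `X` and `Y` act
by `X ⊗ X` and `Y ⊗ Y`. -/
def tensor (M : WeightModule σ t ω.carrier) (N : WeightModule σ s ω.carrier) (h : t * s = r) :
    WeightModule σ r ω.carrier :=
  of (M.carrier ⊗[R] N.carrier)
    (diagonal σ M.actX N.actX M.actX_smul N.actX_smul)
    (diagonal σ.symm M.actY N.actY M.actY_smul N.actY_smul)
    (fun _ _ ↦ diagonal_smul ..) (fun _ _ ↦ diagonal_smul ..)
    (fun v ↦ by
      induction v using TensorProduct.induction_on with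
      | zero => simp
      | tmul v w =>
        rw [diagonal_tmul, diagonal_tmul, actY_actX, actY_actX, smul_tmul_smul, h]
      | add v w hv hw => rw [map_add, map_add, hv, hw, smul_add])
    (fun v ↦ by
      induction v using TensorProduct.induction_on with
      | zero => simp
      | tmul v w =>
        rw [diagonal_tmul, diagonal_tmul, actX_actY, actX_actY, smul_tmul_smul, ← map_mul, h]
      | add v w hv hw => rw [map_add, map_add, hv, hw, smul_add])
    (by
      have := M.isWeight.moduleFinite ω.finite
      have := N.isWeight.moduleFinite ω.finite
      refine isWeight_of ω.finite fun r hr v ↦ ?_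
      induction v using TensorProduct.induction_on with
      | zero => simp
      | tmul v w => rw [smul_tmul', M.isWeight.smul_eq_zero hr, zero_tmul]
      | add v w hv hw => rw [smul_add, hv, hw, add_zero])

/-- The element `v ⊗ w` of the tensor product of two weight modules. -/
def tmul (M : WeightModule σ t ω.carrier) (N : WeightModule σ s ω.carrier) (h : t * s = r)
    (v : M.carrier) (w : N.carrier) : (M.tensor N h).carrier := v ⊗ₜ[R] w

theorem X_smul_tmul (M : WeightModule σ t ω.carrier) (N : WeightModule σ s ω.carrier)
    (h : t * s = r) (v : M.carrier) (w : N.carrier) :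
    GWA.X σ r • tmul M N h v w = tmul M N h (GWA.X σ t • v) (GWA.X σ s • w) :=
  of_X_smul ..

theorem Y_smul_tmul (M : WeightModule σ t ω.carrier) (N : WeightModule σ s ω.carrier)
    (h : t * s = r) (v : M.carrier) (w : N.carrier) :
    GWA.Y σ r • tmul M N h v w = tmul M N h (GWA.Y σ t • v) (GWA.Y σ s • w) :=
  of_Y_smul ..

theorem tensor_induction {M : WeightModule σ t ω.carrier} {N : WeightModule σ s ω.carrier}
    {h : t * s = r} {P : (M.tensor N h).carrier → Prop}
    (zero : P 0) (tmul : ∀ v w, P (tmul M N h v w)) (add : ∀ a b, P a → P b → P (a + b))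
    (a : (M.tensor N h).carrier) : P a :=
  TensorProduct.induction_on (motive := P) a zero tmul add

theorem tmul_add_left {M : WeightModule σ t ω.carrier} {N : WeightModule σ s ω.carrier}
    {h : t * s = r} (v v' : M.carrier) (w : N.carrier) :
    tmul M N h (v + v') w = tmul M N h v w + tmul M N h v' w := TensorProduct.add_tmul ..

theorem tmul_zero_left {M : WeightModule σ t ω.carrier} {N : WeightModule σ s ω.carrier}
    {h : t * s = r} (w : N.carrier) : tmul M N h 0 w = 0 := TensorProduct.zero_tmul ..

/-- An `R`-linear bijection out of a tensor product that commutes with `X` and `Y` on pure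
tensors is an isomorphism. -/
theorem Iso.of_tensor {M : WeightModule σ t ω.carrier} {N : WeightModule σ s ω.carrier}
    {h : t * s = r} {K : WeightModule σ r ω.carrier}
    (e : (M.tensor N h).carrier ≃ₗ[R] K.carrier)
    (hX : ∀ v w, e (tmul M N h (GWA.X σ t • v) (GWA.X σ s • w)) = GWA.X σ r • e (tmul M N h v w))
    (hY : ∀ v w, e (tmul M N h (GWA.Y σ t • v) (GWA.Y σ s • w)) = GWA.Y σ r • e (tmul M N h v w)) :
    Iso (M.tensor N h) K := by
  refine Iso.of_addEquiv e.toAddEquiv (fun r v ↦ e.map_smul r v) (fun v ↦ ?_) fun v ↦ ?_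
  · induction v using tensor_induction with
    | zero => rw [smul_zero, map_zero, smul_zero]
    | tmul v w => rw [X_smul_tmul]; exact hX v w
    | add v w hv hw => rw [smul_add, map_add, map_add, smul_add, hv, hw]
  · induction v using tensor_induction with
    | zero => rw [smul_zero, map_zero, smul_zero]
    | tmul v w => rw [Y_smul_tmul]; exact hY v w
    | add v w hv hw => rw [smul_add, map_add, map_add, smul_add, hv, hw]

/-- An isomorphism of weight modules as an `R`-linear bijection. -/
def baseEquiv {M N : WeightModule σ t ω.carrier} (e : M.carrier ≃ₗ[GWA σ t] N.carrier) :
    M.carrier ≃ₗ[R] N.carrier :=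
  { e.toAddEquiv with map_smul' := equiv_smul e }

theorem tensor_congr {M M' : WeightModule σ t ω.carrier} {N N' : WeightModule σ s ω.carrier}
    (h : t * s = r) : Iso M M' → Iso N N' → Iso (M.tensor N h) (M'.tensor N' h) := by
  rintro ⟨e⟩ ⟨f⟩
  refine Iso.of_tensor (K := M'.tensor N' h) (TensorProduct.congr (baseEquiv e) (baseEquiv f))
    (fun v w ↦ ?_) fun v w ↦ ?_
  · refine Eq.trans ?_ (X_smul_tmul M' N' h (e v) (f w)).symm
    exact congrArg₂ (tmul M' N' h) (map_smul e _ v) (map_smul f _ w)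
  · refine Eq.trans ?_ (Y_smul_tmul M' N' h (e v) (f w)).symm
    exact congrArg₂ (tmul M' N' h) (map_smul e _ v) (map_smul f _ w)

theorem directSum_congr {M M' N N' : WeightModule σ t ω.carrier} :
    Iso M M' → Iso N N' → Iso (M.directSum N) (M'.directSum N') := by
  rintro ⟨e⟩ ⟨f⟩
  exact ⟨LinearEquiv.prodCongr e f⟩

theorem directSum_comm (M N : WeightModule σ t ω.carrier) :
    Iso (M.directSum N) (N.directSum M) :=
  ⟨LinearEquiv.prodComm _ _ _⟩

theorem directSum_assoc (M N K : WeightModule σ t ω.carrier) :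
    Iso ((M.directSum N).directSum K) (M.directSum (N.directSum K)) :=
  ⟨LinearEquiv.prodAssoc _ _ _ _⟩

theorem zero_directSum (M : WeightModule σ t ω.carrier) :
    Iso ((zero σ t ω).directSum M) M :=
  have : Unique (zero σ t ω).carrier := inferInstanceAs (Unique PUnit)
  ⟨LinearEquiv.uniqueProd⟩

theorem tensor_comm (M : WeightModule σ t ω.carrier) (N : WeightModule σ s ω.carrier)
    (h : t * s = r) (h' : s * t = r) : Iso (M.tensor N h) (N.tensor M h') :=
  Iso.of_tensor (K := N.tensor M h') (TensorProduct.comm R _ _)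
    (fun v w ↦ (X_smul_tmul N M h' w v).symm) (fun v w ↦ (Y_smul_tmul N M h' w v).symm)

/-- The associativity of the tensor product. -/
def assocEquiv {t₁ t₂ t₃ t₁₂ t₂₃ : R} (M : WeightModule σ t₁ ω.carrier)
    (N : WeightModule σ t₂ ω.carrier) (K : WeightModule σ t₃ ω.carrier) (h₁ : t₁ * t₂ = t₁₂)
    (h₂ : t₁₂ * t₃ = r) (h₃ : t₂ * t₃ = t₂₃) (h₄ : t₁ * t₂₃ = r) :
    ((M.tensor N h₁).tensor K h₂).carrier ≃ₗ[R] (M.tensor (N.tensor K h₃) h₄).carrier :=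
  TensorProduct.assoc R M.carrier N.carrier K.carrier

theorem assocEquiv_tmul {t₁ t₂ t₃ t₁₂ t₂₃ : R} (M : WeightModule σ t₁ ω.carrier)
    (N : WeightModule σ t₂ ω.carrier) (K : WeightModule σ t₃ ω.carrier) (h₁ : t₁ * t₂ = t₁₂)
    (h₂ : t₁₂ * t₃ = r) (h₃ : t₂ * t₃ = t₂₃) (h₄ : t₁ * t₂₃ = r) (v : M.carrier) (w : N.carrier)
    (x : K.carrier) :
    assocEquiv M N K h₁ h₂ h₃ h₄ (tmul (M.tensor N h₁) K h₂ (tmul M N h₁ v w) x) =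
      tmul M (N.tensor K h₃) h₄ v (tmul N K h₃ w x) := rfl

theorem tensor_assoc {t₁ t₂ t₃ t₁₂ t₂₃ : R} (M : WeightModule σ t₁ ω.carrier)
    (N : WeightModule σ t₂ ω.carrier) (K : WeightModule σ t₃ ω.carrier) (h₁ : t₁ * t₂ = t₁₂)
    (h₂ : t₁₂ * t₃ = r) (h₃ : t₂ * t₃ = t₂₃) (h₄ : t₁ * t₂₃ = r) :
    Iso ((M.tensor N h₁).tensor K h₂) (M.tensor (N.tensor K h₃) h₄) := by
  refine Iso.of_tensor (assocEquiv M N K h₁ h₂ h₃ h₄) (fun v w ↦ ?_) fun v w ↦ ?_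
  · induction v using tensor_induction with
    | zero => rw [smul_zero, tmul_zero_left, tmul_zero_left, map_zero, smul_zero]
    | tmul v v' => simp only [X_smul_tmul, assocEquiv_tmul]
    | add v v' hv hw =>
      rw [smul_add, tmul_add_left, tmul_add_left, map_add, map_add, smul_add, hv, hw]
  · induction v using tensor_induction with
    | zero => rw [smul_zero, tmul_zero_left, tmul_zero_left, map_zero, smul_zero]
    | tmul v v' => simp only [Y_smul_tmul, assocEquiv_tmul]
    | add v v' hv hw =>
      rw [smul_add, tmul_add_left, tmul_add_left, map_add, map_add, smul_add, hv, hw]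

theorem zero_tensor (N : WeightModule σ s ω.carrier) (h : t * s = r) :
    Iso ((zero σ t ω).tensor N h) (zero σ r ω) := by
  have key : ∀ a : ((zero σ t ω).tensor N h).carrier, a = 0 := fun a ↦ by
    induction a using tensor_induction with
    | zero => rfl
    | tmul v w => exact tmul_zero_left w
    | add v w hv hw => rw [hv, hw, add_zero]
  exact Iso.of_tensor
    { toFun := fun _ ↦ 0, invFun := fun _ ↦ 0, map_add' := fun _ _ ↦ rfl,
      map_smul' := fun _ _ ↦ rfl, left_inv := fun a ↦ (key a).symm,
      right_inv := fun _ ↦ rfl } (fun _ _ ↦ rfl) (fun _ _ ↦ rfl)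

theorem directSum_tensor (M M' : WeightModule σ t ω.carrier) (N : WeightModule σ s ω.carrier)
    (h : t * s = r) :
    Iso ((M.directSum M').tensor N h) ((M.tensor N h).directSum (M'.tensor N h)) :=
  Iso.of_tensor (M := M.directSum M') (K := (M.tensor N h).directSum (M'.tensor N h))
    (TensorProduct.prodLeft R R M.carrier M'.carrier N.carrier)
    (fun v w ↦ Prod.ext (X_smul_tmul M N h v.1 w).symm (X_smul_tmul M' N h v.2 w).symm)
    (fun v w ↦ Prod.ext (Y_smul_tmul M N h v.1 w).symm (Y_smul_tmul M' N h v.2 w).symm)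

section unit

theorem map_mem_idealOf (ω : FiniteOrbit σ) (i : ℤ) {r : R} (hr : r ∈ idealOf ω.carrier) :
    (σ ^ i) r ∈ idealOf ω.carrier := by
  rw [mem_idealOf] at hr ⊢
  intro m hm
  obtain ⟨j, hj⟩ := (ω.mem_iff m).1 hm
  let n : MaximalSpectrum R := ⟨ω.base.asIdeal.map (σ ^ (j - i) : RingAut R),
    Ideal.map_isMaximal_of_equiv _⟩
  have hn : r ∈ ω.base.asIdeal.map (σ ^ (j - i) : RingAut R) :=
    hr n ((ω.mem_iff n).2 ⟨j - i, rfl⟩)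
  rw [hj]
  obtain ⟨x, hx, rfl⟩ := (Ideal.mem_map_of_equiv _ _).1 hn
  refine (Ideal.mem_map_of_equiv _ _).2 ⟨x, hx, ?_⟩
  rw [← RingAut.mul_apply, ← zpow_add]
  congr 1
  group

/-- The ring endomorphism of `R ⧸ I` induced by `σ`, where `I` is the intersection of the maximal
ideals in the orbit. -/
def quotX (ω : FiniteOrbit σ) : R ⧸ idealOf ω.carrier →+* R ⧸ idealOf ω.carrier :=
  Ideal.quotientMap _ (σ : R →+* R) fun r hr ↦ by
    simpa using map_mem_idealOf ω 1 hr

/-- The ring endomorphism of `R ⧸ I` induced by the inverse of `σ`. -/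
def quotY (ω : FiniteOrbit σ) : R ⧸ idealOf ω.carrier →+* R ⧸ idealOf ω.carrier :=
  Ideal.quotientMap _ (σ.symm : R →+* R) fun r hr ↦ by
    simpa using map_mem_idealOf ω (-1) hr

/-- The unit for the tensor product: the `R`-module `R ⧸ I`, where `I` is the intersection of the
maximal ideals in the orbit, with `X` acting by `σ`. -/
def unit (ω : FiniteOrbit σ) : WeightModule σ 1 ω.carrier :=
  of (R ⧸ idealOf ω.carrier) (quotX ω).toAddMonoidHom (quotY ω).toAddMonoidHom
    (fun r v ↦ by
      obtain ⟨v, rfl⟩ := Ideal.Quotient.mk_surjective v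
      simp [quotX, Algebra.smul_def, ← map_mul])
    (fun r v ↦ by
      obtain ⟨v, rfl⟩ := Ideal.Quotient.mk_surjective v
      simp [quotY, Algebra.smul_def, ← map_mul])
    (fun v ↦ by
      obtain ⟨v, rfl⟩ := Ideal.Quotient.mk_surjective v
      simp [quotX, quotY])
    (fun v ↦ by
      obtain ⟨v, rfl⟩ := Ideal.Quotient.mk_surjective v
      simp [quotX, quotY])
    (isWeight_of ω.finite fun r hr v ↦ by
      rw [Algebra.smul_def, Ideal.Quotient.algebraMap_eq, Ideal.Quotient.eq_zero_iff_mem.2 hr,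
        zero_mul])

/-- The class of an element of `R` in the unit. -/
def toUnit (ω : FiniteOrbit σ) (r : R) : (unit ω).carrier := Ideal.Quotient.mk _ r

theorem X_smul_toUnit (ω : FiniteOrbit σ) (r : R) :
    GWA.X σ 1 • toUnit ω r = toUnit ω (σ r) := of_X_smul ..

theorem Y_smul_toUnit (ω : FiniteOrbit σ) (r : R) :
    GWA.Y σ 1 • toUnit ω r = toUnit ω (σ.symm r) := of_Y_smul ..

/-- The canonical map of the tensor product with the unit. -/
def unitEquiv (N : WeightModule σ t ω.carrier) :
    ((unit ω).tensor N (one_mul t)).carrier ≃ₗ[R] N.carrier :=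
  let f : (R ⧸ idealOf ω.carrier) →ₗ[R] N.carrier →ₗ[R] N.carrier :=
    Submodule.liftQ (idealOf ω.carrier) (LinearMap.lsmul R N.carrier) fun r hr ↦
      LinearMap.ext fun v ↦ N.isWeight.smul_eq_zero hr v
  LinearEquiv.ofLinearMap (M := (R ⧸ idealOf ω.carrier) ⊗[R] N.carrier) (TensorProduct.lift f)
    (TensorProduct.mk R (R ⧸ idealOf ω.carrier) N.carrier 1)
    (LinearMap.ext fun v ↦ one_smul R v)
    (TensorProduct.ext' fun r v ↦ by
      obtain ⟨r, rfl⟩ := Ideal.Quotient.mk_surjective r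
      change (1 : R ⧸ idealOf ω.carrier) ⊗ₜ[R] (r • v) = _
      rw [tmul_smul, smul_tmul', Algebra.smul_def, mul_one]
      rfl)

theorem unitEquiv_tmul (N : WeightModule σ t ω.carrier) (r : R) (v : N.carrier) :
    unitEquiv N (tmul _ _ (one_mul t) (toUnit ω r) v) = r • v := rfl

theorem unit_tensor (N : WeightModule σ t ω.carrier) :
    Iso ((unit ω).tensor N (one_mul t)) N := by
  refine Iso.of_tensor (unitEquiv N) (fun v w ↦ ?_) fun v w ↦ ?_
  · obtain ⟨r, rfl⟩ : ∃ r, toUnit ω r = v := Ideal.Quotient.mk_surjective v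
    rw [X_smul_toUnit, unitEquiv_tmul, unitEquiv_tmul, X_smul_smul]
  · obtain ⟨r, rfl⟩ : ∃ r, toUnit ω r = v := Ideal.Quotient.mk_surjective v
    rw [Y_smul_toUnit, unitEquiv_tmul, unitEquiv_tmul, Y_smul_smul]

end unit

end operations

end WeightModule

/-! ### The split Grothendieck ring -/

/-- Isomorphism classes of weight modules over `A(R, σ, 1)` with support in the orbit `ω`. -/
def IsoClass {R : Type u} [CommRing R] {σ : RingAut R} (ω : FiniteOrbit σ) : Type (u + 1) :=
  Quotient (WeightModule.setoid σ 1 ω.carrier)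

namespace IsoClass

open WeightModule

variable {R : Type u} [CommRing R] {σ : RingAut R} (ω : FiniteOrbit σ)

variable {ω} in
/-- The isomorphism class of a module. -/
def mk (M : WeightModule σ 1 ω.carrier) : IsoClass ω := Quotient.mk _ M

variable {ω} in
theorem mk_eq_mk {M N : WeightModule σ 1 ω.carrier} : mk M = mk N ↔ Iso M N := Quotient.eq

/-- Addition is induced by the direct sum. -/
instance : Add (IsoClass ω) :=
  ⟨Quotient.map₂ directSum fun _ _ h _ _ h' ↦ directSum_congr h h'⟩

/-- Multiplication is induced by the tensor product over `R`. -/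
instance : Mul (IsoClass ω) :=
  ⟨Quotient.map₂ (fun M N ↦ M.tensor N (one_mul 1)) fun _ _ h _ _ h' ↦ tensor_congr _ h h'⟩

instance : Zero (IsoClass ω) := ⟨mk (zero σ 1 ω)⟩

instance : One (IsoClass ω) := ⟨mk (unit ω)⟩

theorem mul_comm' (a b : IsoClass ω) : a * b = b * a := by
  induction a using Quotient.inductionOn
  induction b using Quotient.inductionOn
  exact mk_eq_mk.2 (tensor_comm ..)

theorem one_mul' (a : IsoClass ω) : 1 * a = a := by
  induction a using Quotient.inductionOn
  exact mk_eq_mk.2 (unit_tensor _)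

theorem zero_mul' (a : IsoClass ω) : 0 * a = 0 := by
  induction a using Quotient.inductionOn
  exact mk_eq_mk.2 (zero_tensor ..)

theorem add_mul' (a b c : IsoClass ω) : (a + b) * c = a * c + b * c := by
  induction a using Quotient.inductionOn
  induction b using Quotient.inductionOn
  induction c using Quotient.inductionOn
  exact mk_eq_mk.2 (directSum_tensor ..)

theorem add_comm' (a b : IsoClass ω) : a + b = b + a := by
  induction a using Quotient.inductionOn
  induction b using Quotient.inductionOn
  exact mk_eq_mk.2 (directSum_comm ..)

theorem zero_add' (a : IsoClass ω) : 0 + a = a := by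
  induction a using Quotient.inductionOn
  exact mk_eq_mk.2 (zero_directSum _)

instance : CommSemiring (IsoClass ω) where
  add_assoc a b c := by
    induction a using Quotient.inductionOn
    induction b using Quotient.inductionOn
    induction c using Quotient.inductionOn
    exact mk_eq_mk.2 (directSum_assoc ..)
  zero_add := zero_add' ω
  add_zero a := by rw [add_comm', zero_add']
  add_comm := add_comm' ω
  nsmul := nsmulRec
  mul_assoc a b c := by
    induction a using Quotient.inductionOn
    induction b using Quotient.inductionOn
    induction c using Quotient.inductionOn
    exact mk_eq_mk.2 (tensor_assoc ..)
  one_mul := one_mul' ω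
  mul_one a := by rw [mul_comm', one_mul']
  mul_comm := mul_comm' ω
  zero_mul := zero_mul' ω
  mul_zero a := by rw [mul_comm', zero_mul']
  right_distrib := add_mul' ω
  left_distrib a b c := by rw [mul_comm', add_mul', mul_comm' ω b, mul_comm' ω c]

end IsoClass

/-- The Grothendieck group of the additive monoid of a commutative semiring. -/
def GrothendieckRing (S : Type u) [CommSemiring S] : Type u := Algebra.GrothendieckAddGroup S

namespace GrothendieckRing

variable {S : Type u} [CommSemiring S]

instance : AddCommGroup (GrothendieckRing S) :=
  inferInstanceAs (AddCommGroup (Algebra.GrothendieckAddGroup S))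

/-- The canonical map. -/
def of : S →+ GrothendieckRing S := Algebra.GrothendieckAddGroup.of

/-- The universal property of the Grothendieck group. -/
def lift {G : Type*} [AddCommGroup G] (f : S →+ G) : GrothendieckRing S →+ G :=
  Algebra.GrothendieckAddGroup.lift f

theorem lift_of {G : Type*} [AddCommGroup G] (f : S →+ G) (a : S) : lift f (of a) = f a :=
  DFunLike.congr_fun (Algebra.GrothendieckAddGroup.lift.symm_apply_apply f) a

theorem hom_ext {G : Type*} [AddCommGroup G] {f g : GrothendieckRing S →+ G}
    (h : ∀ a, f (of a) = g (of a)) : f = g :=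
  Algebra.GrothendieckAddGroup.lift.symm.injective (AddMonoidHom.ext h)

/-- The biadditive extension of the multiplication. -/
def mulHom : GrothendieckRing S →+ GrothendieckRing S →+ GrothendieckRing S :=
  lift
    { toFun := fun a ↦ lift (of.comp (AddMonoidHom.mulLeft a))
      map_zero' := hom_ext fun b ↦ by simp [lift_of]
      map_add' := fun a a' ↦ hom_ext fun b ↦ by simp [lift_of, add_mul] }

theorem mulHom_of (a b : S) : mulHom (of a) (of b) = of (a * b) := by
  simp [mulHom, lift_of]

instance : Mul (GrothendieckRing S) := ⟨fun a b ↦ mulHom a b⟩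

instance : One (GrothendieckRing S) := ⟨of 1⟩

theorem mul_def (a b : GrothendieckRing S) : a * b = mulHom a b := rfl

theorem of_mul (a b : S) : of (a * b) = of a * of b := (mulHom_of a b).symm

theorem of_one : of (1 : S) = 1 := rfl

theorem induction {P : GrothendieckRing S → Prop} (of : ∀ a, P (of a))
    (sub : ∀ a b, P a → P b → P (a - b)) (a : GrothendieckRing S) : P a := by
  have key : ∀ x : Algebra.GrothendieckAddGroup S, P x := fun x ↦ by
    induction x using AddLocalization.ind with
    | _ y =>
      obtain ⟨a, b, hb⟩ := y
      have h := sub _ _ (of a) (of b)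
      have e : (AddLocalization.mk a ⟨b, hb⟩ : Algebra.GrothendieckAddGroup S) =
          Algebra.GrothendieckAddGroup.of a - Algebra.GrothendieckAddGroup.of b := by
        change _ = (AddLocalization.mk a 0 : Algebra.GrothendieckAddGroup S) -
          (AddLocalization.mk b 0 : Algebra.GrothendieckAddGroup S)
        rw [Algebra.GrothendieckAddGroup.mk_sub_mk]
        congr 1
        · simp
        · exact Subtype.ext (by simp)
      rw [e]
      exact h
  exact key a

theorem mul_comm' (a b : GrothendieckRing S) : a * b = b * a := by
  rw [mul_def, mul_def]
  induction a using induction with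
  | sub a a' h h' => simp [h, h']
  | of a =>
    induction b using induction with
    | sub b b' h h' => simp [h, h']
    | of b => rw [mulHom_of, mulHom_of, mul_comm]

theorem mul_assoc' (a b c : GrothendieckRing S) : a * b * c = a * (b * c) := by
  simp only [mul_def]
  induction a using induction with
  | sub a a' h h' => simp [h, h']
  | of a =>
    induction b using induction with
    | sub b b' h h' => simp [h, h']
    | of b =>
      induction c using induction with
      | sub c c' h h' => simp [h, h']
      | of c => simp only [mulHom_of, mul_assoc]

theorem one_mul' (a : GrothendieckRing S) : 1 * a = a := by
  rw [mul_def]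
  induction a using induction with
  | sub a a' h h' => simp [h, h']
  | of a => rw [← of_one, mulHom_of, one_mul]

/-- The Grothendieck ring of a commutative semiring. -/
instance : CommRing (GrothendieckRing S) where
  __ := (inferInstance : AddCommGroup (GrothendieckRing S))
  mul_comm := mul_comm'
  mul_assoc := mul_assoc'
  one_mul := one_mul'
  mul_one a := by rw [mul_comm', one_mul']
  zero_mul a := by rw [mul_def, map_zero, AddMonoidHom.zero_apply]
  mul_zero a := by rw [mul_def, map_zero]
  left_distrib a b c := by rw [mul_def, map_add]; rfl
  right_distrib a b c := by rw [mul_def, map_add]; rfl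

end GrothendieckRing

/-- The complexified split Grothendieck ring `ℂ ⊗ K₀` of the weight modules over `A(R, σ, 1)` with
support in `ω`. -/
abbrev SplitGrothendieckRing {R : Type u} [CommRing R] {σ : RingAut R} (ω : FiniteOrbit σ) :
    Type (u + 1) :=
  ℂ ⊗[ℤ] GrothendieckRing (IsoClass ω)

/-- The class of a module in the split Grothendieck ring. -/
def splitClass {R : Type u} [CommRing R] {σ : RingAut R} {ω : FiniteOrbit σ}
    (M : WeightModule σ 1 ω.carrier) : SplitGrothendieckRing ω :=
  1 ⊗ₜ GrothendieckRing.of (IsoClass.mk M)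


/-! ### The algebra `ℂ[z, z⁻¹]` and the orbit of `z - 1` -/

namespace SkewLaurent

open LaurentPolynomial

theorem laurent_hom_ext {S : Type*} [CommRing S] {f g : ℂ[T;T⁻¹] →+* S}
    (hC : ∀ a, f (C a) = g (C a)) (hT : f (T 1) = g (T 1)) : f = g := by
  have hu : Units.map f.toMonoidHom (isUnit_T (R := ℂ) 1).unit =
      Units.map g.toMonoidHom (isUnit_T (R := ℂ) 1).unit := Units.ext hT
  have hv (n : ℤ) : (((isUnit_T (R := ℂ) 1).unit ^ n : ℂ[T;T⁻¹]ˣ) : ℂ[T;T⁻¹]) = T n := by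
    induction n with
    | zero => simp
    | succ n ih => rw [zpow_add_one, Units.val_mul, ih, T_add, IsUnit.unit_spec]
    | pred n ih =>
      rw [zpow_sub_one, Units.val_mul, ih, Units.mul_inv_eq_iff_eq_mul, IsUnit.unit_spec, ← T_add,
        sub_add_cancel]
  refine RingHom.ext fun x ↦ ?_
  induction x using LaurentPolynomial.induction_on' with
  | add x y hx hy => rw [map_add, map_add, hx, hy]
  | C_mul_T n a =>
    rw [map_mul, map_mul, hC, ← hv]
    have := congrArg (fun u : Sˣ ↦ ((u ^ n : Sˣ) : S)) hu
    rw [← map_zpow, ← map_zpow] at this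
    exact congrArg _ this

/-- Evaluation of Laurent polynomials at `c`. -/
def evalAt (c : ℂˣ) : ℂ[T;T⁻¹] →+* ℂ := eval₂ (RingHom.id ℂ) c

@[simp] theorem evalAt_C (c : ℂˣ) (a : ℂ) : evalAt c (C a) = a := by simp [evalAt]

@[simp] theorem evalAt_T (c : ℂˣ) : evalAt c (T 1) = c := by simp [evalAt]

/-- The ring homomorphism over `ℂ` that sends `z` to `c z`. -/
def scaleHom (c : ℂˣ) : ℂ[T;T⁻¹] →+* ℂ[T;T⁻¹] :=
  eval₂ C (Units.map (C : ℂ →+* ℂ[T;T⁻¹]).toMonoidHom c * (isUnit_T 1).unit)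

@[simp] theorem scaleHom_C (c : ℂˣ) (a : ℂ) : scaleHom c (C a) = C a := by simp [scaleHom]

@[simp] theorem scaleHom_T (c : ℂˣ) : scaleHom c (T 1) = C (c : ℂ) * T 1 := by simp [scaleHom]

theorem scaleHom_comp (c d : ℂˣ) : (scaleHom c).comp (scaleHom d) = scaleHom (c * d) :=
  laurent_hom_ext (fun a ↦ by simp) (by simp; ring)

theorem scaleHom_one : scaleHom 1 = RingHom.id _ :=
  laurent_hom_ext (fun a ↦ by simp) (by simp)

/-- The automorphism of `ℂ[z, z⁻¹]` over `ℂ` that sends `z` to `c z`. -/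
def scale (c : ℂˣ) : RingAut ℂ[T;T⁻¹] :=
  RingEquiv.ofRingHom (scaleHom c) (scaleHom c⁻¹)
    (by rw [scaleHom_comp, mul_inv_cancel, scaleHom_one])
    (by rw [scaleHom_comp, inv_mul_cancel, scaleHom_one])

theorem scale_apply (c : ℂˣ) (f : ℂ[T;T⁻¹]) : scale c f = scaleHom c f := rfl

theorem scale_C (c : ℂˣ) (a : ℂ) : scale c (C a) = C a := scaleHom_C c a

theorem scale_T (c : ℂˣ) : scale c (T 1) = C (c : ℂ) * T 1 := scaleHom_T c

theorem scale_mul (c d : ℂˣ) : scale (c * d) = scale c * scale d :=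
  RingEquiv.ext fun f ↦ (DFunLike.congr_fun (scaleHom_comp c d) f).symm

theorem scale_zpow (c : ℂˣ) (i : ℤ) : scale c ^ i = scale (c ^ i) :=
  (map_zpow (MonoidHom.mk' scale scale_mul) c i).symm

theorem scale_symm (c : ℂˣ) : (scale c).symm = scale c⁻¹ :=
  (map_inv (MonoidHom.mk' scale scale_mul) c).symm

theorem evalAt_scale (c d : ℂˣ) (f : ℂ[T;T⁻¹]) : evalAt c (scale d f) = evalAt (c * d) f := by
  refine DFunLike.congr_fun (f := (evalAt c).comp (scaleHom d)) (g := evalAt (c * d)) ?_ f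
  exact laurent_hom_ext (fun a ↦ by simp) (by simp; ring)

/-- The ideal generated by `z - c`. -/
def pointIdeal (c : ℂˣ) : Ideal ℂ[T;T⁻¹] := Ideal.span {T 1 - C (c : ℂ)}

theorem mem_pointIdeal (c : ℂˣ) (f : ℂ[T;T⁻¹]) : f ∈ pointIdeal c ↔ evalAt c f = 0 := by
  have h : (Ideal.Quotient.mk (pointIdeal c)) =
      ((Ideal.Quotient.mk (pointIdeal c)).comp C).comp (evalAt c) := by
    refine laurent_hom_ext (fun a ↦ by simp) ?_
    simp only [RingHom.comp_apply, evalAt_T]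
    exact (Ideal.Quotient.mk_eq_mk_iff_sub_mem _ _).2 (Ideal.subset_span rfl)
  refine ⟨fun hf ↦ ?_, fun hf ↦ ?_⟩
  · have : pointIdeal c ≤ RingHom.ker (evalAt c) :=
      Ideal.span_le.2 (Set.singleton_subset_iff.2 (by simp [RingHom.mem_ker]))
    exact this hf
  · rw [← Ideal.Quotient.eq_zero_iff_mem, h]
    simp [hf]

theorem pointIdeal_isMaximal (c : ℂˣ) : (pointIdeal c).IsMaximal := by
  have h : pointIdeal c = RingHom.ker (evalAt c) := Ideal.ext fun f ↦ mem_pointIdeal c f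
  rw [h]
  exact RingHom.ker_isMaximal_of_surjective _ fun a ↦ ⟨C a, evalAt_C c a⟩

theorem map_scale_pointIdeal (c d : ℂˣ) :
    (pointIdeal c).map (scale d) = pointIdeal (c * d⁻¹) := by
  ext f
  rw [Ideal.mem_map_of_equiv, mem_pointIdeal]
  constructor
  · rintro ⟨g, hg, rfl⟩
    rw [evalAt_scale, inv_mul_cancel_right]
    exact (mem_pointIdeal c g).1 hg
  · refine fun h ↦ ⟨scale d⁻¹ f, ?_, ?_⟩
    · rwa [mem_pointIdeal, evalAt_scale]
    · rw [← RingAut.mul_apply, ← scale_mul, mul_inv_cancel, scale_apply, scaleHom_one]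
      rfl

/-- The maximal ideal generated by `z - c`. -/
def point (c : ℂˣ) : MaximalSpectrum ℂ[T;T⁻¹] := ⟨pointIdeal c, pointIdeal_isMaximal c⟩

/-- The primitive root of unity `q = exp(2πi/p)`. -/
def rootQ (p : ℕ) : ℂˣ :=
  Units.mk0 (Complex.exp (2 * Real.pi * Complex.I / p)) (Complex.exp_ne_zero _)

theorem rootQ_pow (p : ℕ) [NeZero p] : rootQ p ^ p = 1 :=
  Units.ext (Complex.isPrimitiveRoot_exp p (NeZero.ne p)).pow_eq_one

/-- The automorphism `σ` of `ℂ[z, z⁻¹]` with `σ(z) = q⁻¹ z`. -/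
def sigma (p : ℕ) : RingAut ℂ[T;T⁻¹] := scale (rootQ p)⁻¹

theorem map_sigma_zpow (p : ℕ) (i : ℤ) :
    (pointIdeal 1).map (sigma p ^ i : RingAut ℂ[T;T⁻¹]) = pointIdeal (rootQ p ^ i) := by
  rw [sigma, scale_zpow, map_scale_pointIdeal, inv_zpow, inv_inv, one_mul]

theorem rootQ_zpow_eq (p : ℕ) [NeZero p] (i : ℤ) :
    ∃ k : Fin p, rootQ p ^ i = rootQ p ^ (k : ℕ) := by
  have hp : (0 : ℤ) < p := by exact_mod_cast Nat.pos_of_ne_zero (NeZero.ne p)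
  have h0 := Int.emod_nonneg i hp.ne'
  have h1 := Int.emod_lt_of_pos i hp
  refine ⟨⟨(i % p).toNat, by omega⟩, ?_⟩
  conv_lhs => rw [← Int.emod_add_mul_ediv i p, zpow_add, zpow_mul, zpow_natCast, rootQ_pow,
    one_zpow, mul_one]
  rw [← zpow_natCast, Int.toNat_of_nonneg h0]

/-- The orbit `ω` of the maximal ideal generated by `z - 1`. -/
def orbit (p : ℕ) [NeZero p] : FiniteOrbit (sigma p) where
  carrier := {m | ∃ i : ℤ, m.asIdeal = (point 1).asIdeal.map (sigma p ^ i : RingAut ℂ[T;T⁻¹])}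
  base := point 1
  mem_iff _ := Iff.rfl
  finite := by
    refine (Set.finite_range fun k : Fin p ↦ point (rootQ p ^ (k : ℕ))).subset ?_
    rintro m ⟨i, hi⟩
    obtain ⟨k, hk⟩ := rootQ_zpow_eq p i
    refine ⟨k, MaximalSpectrum.ext ?_⟩
    rw [hi]
    refine Eq.trans ?_ (map_sigma_zpow p i).symm
    rw [hk]
    rfl

/-- The orbit consists of the ideals generated by `z - q ^ k`. -/
theorem mem_orbit_iff (p : ℕ) [NeZero p] (m : MaximalSpectrum ℂ[T;T⁻¹]) :
    m ∈ (orbit p).carrier ↔ ∃ k : ℕ, k < p ∧ m = point (rootQ p ^ k) := by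
  constructor
  · rintro ⟨i, hi⟩
    obtain ⟨k, hk⟩ := rootQ_zpow_eq p i
    refine ⟨k, k.2, MaximalSpectrum.ext ?_⟩
    rw [hi, ← hk]
    exact map_sigma_zpow p i
  · rintro ⟨k, -, rfl⟩
    refine ⟨k, ?_⟩
    refine Eq.trans ?_ (map_sigma_zpow p k).symm
    rw [zpow_natCast]
    rfl

theorem point_mem_orbit (p : ℕ) [NeZero p] (k : ℕ) :
    point (rootQ p ^ k) ∈ (orbit p).carrier := by
  obtain ⟨j, hj⟩ := rootQ_zpow_eq p k
  rw [zpow_natCast] at hj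
  exact (mem_orbit_iff p _).2 ⟨j, j.2, by rw [hj]⟩

/-! ### The modules attached to invertible matrices -/

/-- The weight of the `k`-th summand, where `k = 0, …, p - 1` stands for the index `k + 1` in
`1, …, p`. -/
def weight (p : ℕ) (k : Fin p) : ℂˣ := rootQ p ^ ((k : ℕ) + 1)

theorem weight_add_one (p : ℕ) [NeZero p] (k : Fin p) :
    weight p (k + 1) = weight p k * rootQ p := by
  rw [weight, weight, ← pow_succ, Fin.val_add, pow_succ, pow_succ, pow_succ]
  congr 1
  rw [← pow_succ, Fin.val_one']
  have h : ((k : ℕ) + 1 % p) % p = (k + 1) % p := by simp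
  rw [h]
  conv_rhs => rw [← Nat.mod_add_div ((k : ℕ) + 1) p, pow_add, pow_mul, rootQ_pow, one_pow, mul_one]

/-- The space `⨁ₖ (R ⧸ (z - q ^ k)) ^ d` for `k = 1, …, p`, where `R ⧸ (z - c)` is identified
with `ℂ` by evaluation at `c`. -/
def CircleSpace (p d : ℕ) : Type := Fin p → Fin d → ℂ

namespace CircleSpace

variable (p d : ℕ)

instance : AddCommGroup (CircleSpace p d) := inferInstanceAs (AddCommGroup (Fin p → Fin d → ℂ))

instance : Module ℂ (CircleSpace p d) := inferInstanceAs (Module ℂ (Fin p → Fin d → ℂ))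

instance : Module.Finite ℂ (CircleSpace p d) :=
  inferInstanceAs (Module.Finite ℂ (Fin p → Fin d → ℂ))

/-- A Laurent polynomial acts on the `k`-th summand by its value at `q ^ (k + 1)`. -/
instance : Module ℂ[T;T⁻¹] (CircleSpace p d) where
  smul f v := fun k ↦ evalAt (weight p k) f • v k
  one_smul v := funext fun k ↦ by change evalAt _ 1 • v k = v k; rw [map_one, one_smul]
  mul_smul f g v := funext fun k ↦ by
    change evalAt _ (f * g) • v k = evalAt _ f • evalAt _ g • v k
    rw [map_mul, mul_smul]
  smul_zero f := funext fun k ↦ smul_zero (evalAt (weight p k) f)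
  smul_add f v w := funext fun k ↦ smul_add (evalAt (weight p k) f) (v k) (w k)
  add_smul f g v := funext fun k ↦ by
    change evalAt _ (f + g) • v k = evalAt _ f • v k + evalAt _ g • v k
    rw [map_add, add_smul]
  zero_smul v := funext fun k ↦ by change evalAt _ 0 • v k = 0; rw [map_zero, zero_smul]

variable {p d}

theorem smul_apply (f : ℂ[T;T⁻¹]) (v : CircleSpace p d) (k : Fin p) :
    (f • v) k = evalAt (weight p k) f • v k := rfl

theorem add_apply (v w : CircleSpace p d) (k : Fin p) : (v + w) k = v k + w k := rfl

instance : IsScalarTower ℂ ℂ[T;T⁻¹] (CircleSpace p d) where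
  smul_assoc a f v := funext fun k ↦ by
    change evalAt _ (a • f) • v k = a • evalAt _ f • v k
    rw [smul_eq_C_mul, map_mul, evalAt_C, mul_smul]

theorem isWeight [NeZero p] : IsWeight (orbit p).carrier (CircleSpace p d) := by
  have : Module.Finite ℂ[T;T⁻¹] (CircleSpace p d) :=
    Module.Finite.of_restrictScalars_finite ℂ ℂ[T;T⁻¹] _
  refine isWeight_of (orbit p).finite fun f hf v ↦ funext fun k ↦ ?_
  rw [smul_apply, weight, (mem_pointIdeal _ _).1 (mem_idealOf.1 hf _ (point_mem_orbit p (k + 1))),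
    zero_smul]
  rfl

variable [NeZero p]

open Matrix in
/-- The action of `X`: the basis vector `e_{k, s}` is sent to `e_{k+1, s}` if `k ≠ p`, and `e_{p, s}`
to `F e_{1, s}`. -/
def actX (F : GL (Fin d) ℂ) : CircleSpace p d →+ CircleSpace p d :=
  AddMonoidHom.mk' (fun v k ↦ if k = 0 then (F : Matrix (Fin d) (Fin d) ℂ) *ᵥ v (k - 1)
    else v (k - 1)) fun v w ↦ funext fun k ↦ by
      change (if k = 0 then F.1 *ᵥ (v (k - 1) + w (k - 1)) else v (k - 1) + w (k - 1)) =
        (if k = 0 then F.1 *ᵥ v (k - 1) else v (k - 1)) + (if k = 0 then F.1 *ᵥ w (k - 1) else w (k - 1))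
      split_ifs
      · rw [mulVec_add]
      · rfl

open Matrix in
/-- The action of `Y`: the basis vector `e_{k, s}` is sent to `e_{k-1, s}` if `k ≠ 1`, and `e_{1, s}`
to `F⁻¹ e_{p, s}`. -/
def actY (F : GL (Fin d) ℂ) : CircleSpace p d →+ CircleSpace p d :=
  AddMonoidHom.mk' (fun v k ↦ if k + 1 = 0
    then ((F⁻¹ : GL (Fin d) ℂ) : Matrix (Fin d) (Fin d) ℂ) *ᵥ v (k + 1)
    else v (k + 1)) fun v w ↦ funext fun k ↦ by
      change (if k + 1 = 0 then F⁻¹.1 *ᵥ (v (k + 1) + w (k + 1)) else v (k + 1) + w (k + 1)) =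
        (if k + 1 = 0 then F⁻¹.1 *ᵥ v (k + 1) else v (k + 1)) + (if k + 1 = 0 then F⁻¹.1 *ᵥ w (k + 1) else w (k + 1))
      split_ifs
      · rw [mulVec_add]
      · rfl

open Matrix in
theorem actX_apply (F : GL (Fin d) ℂ) (v : CircleSpace p d) (k : Fin p) :
    actX F v k = if k = 0 then (F : Matrix (Fin d) (Fin d) ℂ) *ᵥ v (k - 1) else v (k - 1) := rfl

open Matrix in
theorem actY_apply (F : GL (Fin d) ℂ) (v : CircleSpace p d) (k : Fin p) :
    actY F v k = if k + 1 = 0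
      then ((F⁻¹ : GL (Fin d) ℂ) : Matrix (Fin d) (Fin d) ℂ) *ᵥ v (k + 1) else v (k + 1) := rfl

end CircleSpace

/-- The module `V(ω, 1^p, F)` over `A(R, σ, 1)` for an invertible matrix `F`. -/
def circleModule (p : ℕ) [NeZero p] {d : ℕ} (F : GL (Fin d) ℂ) :
    WeightModule (sigma p) 1 (orbit p).carrier :=
  .of (CircleSpace p d) (CircleSpace.actX F) (CircleSpace.actY F)
    (fun f v ↦ funext fun k ↦ by
      obtain ⟨k, rfl⟩ : ∃ j : Fin p, k = j + 1 := ⟨k - 1, (sub_add_cancel _ _).symm⟩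
      have h : evalAt (weight p (k + 1)) (sigma p f) = evalAt (weight p k) f := by
        rw [sigma, evalAt_scale, weight_add_one, mul_inv_cancel_right]
      rw [CircleSpace.smul_apply, CircleSpace.actX_apply, CircleSpace.actX_apply, h,
        add_sub_cancel_right, CircleSpace.smul_apply]
      split_ifs
      · rw [Matrix.mulVec_smul]
      · rfl)
    (fun f v ↦ funext fun k ↦ by
      have h : evalAt (weight p k) ((sigma p).symm f) = evalAt (weight p (k + 1)) f := by
        rw [sigma, scale_symm, inv_inv, evalAt_scale, weight_add_one]
      rw [CircleSpace.smul_apply, CircleSpace.actY_apply, CircleSpace.actY_apply, h,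
        CircleSpace.smul_apply]
      split_ifs
      · rw [Matrix.mulVec_smul]
      · rfl)
    (fun v ↦ funext fun k ↦ by
      rw [one_smul, CircleSpace.actY_apply, CircleSpace.actX_apply, add_sub_cancel_right]
      split_ifs
      · rw [Matrix.mulVec_mulVec, ← Units.val_mul, inv_mul_cancel, Units.val_one, Matrix.one_mulVec]
      · rfl)
    (fun v ↦ funext fun k ↦ by
      rw [map_one, one_smul, CircleSpace.actX_apply, CircleSpace.actY_apply, sub_add_cancel]
      split_ifs
      · rw [Matrix.mulVec_mulVec, ← Units.val_mul, mul_inv_cancel, Units.val_one, Matrix.one_mulVec]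
      · rfl)
    CircleSpace.isWeight

/-- The companion matrix of a polynomial of degree `d`: its last column has the entries
`-αᵢ / α_d`, and the entries below the diagonal are `1`. -/
def companion (f : Polynomial ℂ) : Matrix (Fin f.natDegree) (Fin f.natDegree) ℂ :=
  .of fun i j ↦ if (j : ℕ) + 1 = f.natDegree then -f.coeff i / f.leadingCoeff
    else if (i : ℕ) = j + 1 then 1 else 0

theorem companion_isUnit {f : Polynomial ℂ} (hf : f.coeff 0 ≠ 0) : IsUnit (companion f) := by
  rw [← Matrix.mulVec_injective_iff_isUnit, ← Matrix.coe_mulVecLin, ← LinearMap.ker_eq_bot,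
    LinearMap.ker_eq_bot']
  intro v hv
  have hlc : f.leadingCoeff ≠ 0 :=
    Polynomial.leadingCoeff_ne_zero.2 fun h ↦ hf (by simp [h])
  have h : ∀ i, ∑ j, companion f i j * v j = 0 := fun i ↦ congrFun hv i
  by_cases hd : f.natDegree = 0
  · exact funext fun i ↦ absurd i.2 (by omega)
  have hlast : v ⟨f.natDegree - 1, by omega⟩ = 0 := by
    have h0 := h ⟨0, by omega⟩
    rw [Finset.sum_eq_single ⟨f.natDegree - 1, by omega⟩] at h0
    · have e : f.natDegree - 1 + 1 = f.natDegree := by omega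
      simpa [companion, e, hf, hlc] using h0
    · intro j _ hj
      have e : (j : ℕ) + 1 ≠ f.natDegree := fun e ↦ hj (Fin.ext (by simp; omega))
      simp [companion, e]
    · simp
  funext k
  by_cases hk : (k : ℕ) + 1 = f.natDegree
  · have e : k = ⟨f.natDegree - 1, by omega⟩ := Fin.ext (by simp; omega)
    rw [e]; exact hlast
  · have hk' : (k : ℕ) + 1 < f.natDegree := by have := k.2; omega
    have h0 := h ⟨k + 1, hk'⟩
    rw [Finset.sum_eq_single k] at h0
    · simpa [companion, hk] using h0
    · intro j _ hj
      by_cases e : (j : ℕ) + 1 = f.natDegree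
      · have e' : j = ⟨f.natDegree - 1, by omega⟩ := Fin.ext (by simp; omega)
        rw [e', hlast, mul_zero]
      · have e' : (k : ℕ) ≠ j := fun e' ↦ hj (Fin.ext e'.symm)
        simp [companion, e, e']
    · simp

theorem coeff_zero_ne (ξ : ℂˣ) (a : ℕ) :
    ((Polynomial.X - Polynomial.C (ξ : ℂ)) ^ a).coeff 0 ≠ 0 := by
  simp [Polynomial.coeff_zero_eq_eval_zero]

/-- The class `u(ξ, a)` of the module `V(ω, 1^p, F)`, where `F` is the companion matrix of
`(x - ξ) ^ a`. -/
def u (p : ℕ) [NeZero p] (ξ : ℂˣ) (a : ℕ) : SplitGrothendieckRing (orbit p) :=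
  splitClass (circleModule p (companion_isUnit (coeff_zero_ne ξ a)).unit)

end SkewLaurent

end

noncomputable section

open TensorProduct

namespace SkewLaurent

open LaurentPolynomial

/-! ### The fibre of a weight module at the point `1` -/

/-! Since `X` is invertible and carries the weight space at `q^k` onto the one at `q^(k+1)`, a
weight module amounts to its weight space `W` at `1` with the monodromy `F`, the invertible action
of `X^p` on `W` (`Fiber.iso`). Direct sums go to direct sums, and the tensor product over `R` goes
to `W ⊗ W'` with `F ⊗ F'` (`Fiber.tensor`). So the ring is the split representation ring of one
invertible operator on finite dimensional complex spaces.

By the structure theorem over `ℂ[X]` every such operator is a sum of Jordan blocks with nonzero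
eigenvalues (`exists_eq_sum_block`), so the `u(ξ, a)` span. Tensoring with `u(ξ, 1)` multiplies `F`
by `ξ`, which gives the group relations. For `u(1, 2) u(ξ, n+1)` the full Clebsch-Gordan rule is not
needed: the nilpotency index of the product is exactly `n + 2` (`classRankHom_two_mul_block`), so
the product is a nonzero multiple of `u(ξ, n+2)` plus smaller blocks with the same eigenvalue. Hence
the elements `u(ξ, 1) u(1, 2)^n` are triangular with nonzero diagonal with respect to the `u(ξ,
n+1)`, and the generators generate.

For independence, the rank of a polynomial in `F` is additive on isomorphism classes and so yields
linear functionals. The drop from the rank of `(F - ξ)^n` to that of `(F - ξ)^(n+1)` ignores other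
eigenvalues and blocks of size at most `n`, but not the block of size `n + 1`; it reads off the
leading coefficient of a polynomial in `u(1, 2)` (`polyHom_injective`). The presentation follows
because `ℂ[ℂ^×][x]` has those generators and relations itself (`toPresented_aeval_polyGen`). -/

theorem rootQ_isPrimitiveRoot (p : ℕ) [NeZero p] : IsPrimitiveRoot (rootQ p) p :=
  IsPrimitiveRoot.coe_units_iff.1 (Complex.isPrimitiveRoot_exp p (NeZero.ne p))

/-- A Laurent polynomial that is `1` at the point `1` and vanishes at the other points of the
orbit. -/
def baseIdem (p : ℕ) : ℂ[T;T⁻¹] :=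
  C (∏ k ∈ Finset.Ico 1 p, (1 - (rootQ p ^ k : ℂˣ) : ℂ))⁻¹ *
    ∏ k ∈ Finset.Ico 1 p, (T 1 - C ((rootQ p ^ k : ℂˣ) : ℂ))

theorem evalAt_baseIdem (p : ℕ) [NeZero p] (i : ℕ) :
    evalAt (rootQ p ^ i) (baseIdem p) = if p ∣ i then 1 else 0 := by
  have hq := rootQ_isPrimitiveRoot p
  rw [baseIdem, map_mul, evalAt_C, map_prod]
  split_ifs with h
  · simp only [map_sub, evalAt_T, evalAt_C]
    rw [(hq.pow_eq_one_iff_dvd i).2 h, Units.val_one]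
    -- The normalising product is nonzero: `q` is primitive, so `q^k ≠ 1` for `1 ≤ k < p`.
    refine inv_mul_cancel₀ (Finset.prod_ne_zero_iff.2 fun k hk ↦ sub_ne_zero.2 fun e ↦ ?_)
    rw [Finset.mem_Ico] at hk
    have := (hq.pow_eq_one_iff_dvd k).1 (Units.ext e.symm)
    exact absurd (Nat.le_of_dvd (by omega) this) (by omega)
  -- The factor with `k = i % p` vanishes at `q^i`; it occurs in the product because this residue is
  -- nonzero.
  · refine mul_eq_zero_of_right _ (Finset.prod_eq_zero (i := i % p) ?_ ?_)
    · have h1 : i % p ≠ 0 := fun e ↦ h (Nat.dvd_of_mod_eq_zero e)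
      exact Finset.mem_Ico.2 ⟨by omega, Nat.mod_lt _ (Nat.pos_of_ne_zero (NeZero.ne p))⟩
    · rw [map_sub, evalAt_T, evalAt_C, sub_eq_zero]
      congr 1
      conv_lhs => rw [← Nat.mod_add_div i p, pow_add, pow_mul, rootQ_pow, one_pow, mul_one]

theorem evalAt_one_baseIdem (p : ℕ) [NeZero p] : evalAt 1 (baseIdem p) = 1 := by
  simpa using evalAt_baseIdem p 0

namespace OrbitModule

theorem Y_mul_X {p : ℕ} : GWA.Y (sigma p) 1 * GWA.X (sigma p) 1 = 1 := by
  rw [GWA.Y_mul_X, map_one]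

theorem X_mul_Y {p : ℕ} : GWA.X (sigma p) 1 * GWA.Y (sigma p) 1 = 1 := by
  rw [GWA.X_mul_Y, map_one, map_one]

theorem Y_pow_mul_X_pow {p : ℕ} (j : ℕ) : GWA.Y (sigma p) 1 ^ j * GWA.X (sigma p) 1 ^ j = 1 :=
  pow_mul_pow_eq_one j Y_mul_X

theorem X_pow_mul_Y_pow {p : ℕ} (j : ℕ) : GWA.X (sigma p) 1 ^ j * GWA.Y (sigma p) 1 ^ j = 1 :=
  pow_mul_pow_eq_one j X_mul_Y

end OrbitModule

variable {p : ℕ} [NeZero p]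

/-- The weight modules over `A(1)` supported on the orbit of `z - 1`. -/
abbrev OrbitModule (p : ℕ) [NeZero p] := WeightModule (sigma p) 1 (orbit p).carrier

namespace OrbitModule

variable (M : OrbitModule p)

/-- Functions vanishing on the orbit annihilate `M`, so `R` acts through its values at `p` points.
Identities between idempotents thus become pointwise checks. -/
theorem smul_eq_smul_of_evalAt {f g : ℂ[T;T⁻¹]}
    (h : ∀ k < p, evalAt (rootQ p ^ k) f = evalAt (rootQ p ^ k) g) (m : M.carrier) :
    f • m = g • m := by
  rw [← sub_eq_zero, ← sub_smul]
  refine M.isWeight.smul_eq_zero (mem_idealOf.2 fun n hn ↦ ?_) m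
  obtain ⟨k, hk, rfl⟩ := (mem_orbit_iff p n).1 hn
  exact (mem_pointIdeal _ _).2 (by rw [map_sub, h k hk, sub_self])

theorem smul_baseIdem_smul (f : ℂ[T;T⁻¹]) (m : M.carrier) :
    f • baseIdem p • m = C (evalAt 1 f) • baseIdem p • m := by
  rw [← mul_smul, ← mul_smul]
  refine M.smul_eq_smul_of_evalAt (fun k hk ↦ ?_) m
  rw [map_mul, map_mul, evalAt_baseIdem, evalAt_C]
  split_ifs with h
  · rw [(rootQ_isPrimitiveRoot p).pow_eq_one_iff_dvd k |>.2 h]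
  · simp

theorem baseIdem_smul_baseIdem_smul (m : M.carrier) :
    baseIdem p • baseIdem p • m = baseIdem p • m := by
  rw [smul_baseIdem_smul, evalAt_one_baseIdem, map_one, one_smul]

theorem X_pow_smul_smul (j : ℕ) (f : ℂ[T;T⁻¹]) (m : M.carrier) :
    GWA.X (sigma p) 1 ^ j • f • m = scale ((rootQ p)⁻¹ ^ j) f • GWA.X (sigma p) 1 ^ j • m := by
  induction j generalizing f m with
  | zero => simp [scale_apply, scaleHom_one]
  | succ j ih =>
    rw [pow_succ, mul_smul, M.X_smul_smul, ih, pow_succ, mul_smul, scale_mul]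
    rfl

theorem Y_pow_smul_smul (j : ℕ) (f : ℂ[T;T⁻¹]) (m : M.carrier) :
    GWA.Y (sigma p) 1 ^ j • f • m = scale (rootQ p ^ j) f • GWA.Y (sigma p) 1 ^ j • m := by
  induction j generalizing f m with
  | zero => simp [scale_apply, scaleHom_one]
  | succ j ih =>
    have h : (sigma p).symm = scale (rootQ p) := by rw [sigma, scale_symm, inv_inv]
    rw [pow_succ, mul_smul, M.Y_smul_smul, ih, pow_succ, mul_smul, scale_mul, h]
    rfl

/-- `σ^p = 1` because `q^p = 1`, so `X^p` is `R`-linear and preserves weight spaces. -/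
theorem baseIdem_smul_X_pow_smul (m : M.carrier) :
    baseIdem p • GWA.X (sigma p) 1 ^ p • m = GWA.X (sigma p) 1 ^ p • baseIdem p • m := by
  rw [X_pow_smul_smul, inv_pow, rootQ_pow, inv_one, scale_apply, scaleHom_one]
  rfl

/-- Conjugation by `X^j` turns the idempotent at `1` into the idempotent at `q^(-j)`. -/
theorem Y_pow_smul_baseIdem_smul_X_pow_smul (j : ℕ) (m : M.carrier) :
    GWA.Y (sigma p) 1 ^ j • baseIdem p • GWA.X (sigma p) 1 ^ j • m =
      scale (rootQ p ^ j) (baseIdem p) • m := by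
  rw [Y_pow_smul_smul, ← mul_smul (GWA.Y (sigma p) 1 ^ j), Y_pow_mul_X_pow, one_smul]

/-- The translates of the idempotent form a partition of unity on the orbit. -/
theorem sum_scale_baseIdem_smul (m : M.carrier) :
    ∑ j ∈ Finset.range p, scale (rootQ p ^ j) (baseIdem p) • m = m := by
  rw [← Finset.sum_smul]
  conv_rhs => rw [← one_smul ℂ[T;T⁻¹] m]
  refine M.smul_eq_smul_of_evalAt (fun k hk ↦ ?_) m
  rw [map_sum, map_one]
  simp only [evalAt_scale, ← pow_add, evalAt_baseIdem]
  -- At `q^k` only the translate with `p ∣ k + j` is nonzero; as `0 ≤ j < p`, this is `j = 0` or `j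
  -- = p - k`.
  rw [Finset.sum_eq_single (if k = 0 then 0 else p - k)]
  · split_ifs with h h' h'
    · rfl
    · simp [h] at h'
    · rfl
    · exact absurd (show p ∣ k + (p - k) by rw [Nat.add_sub_cancel' hk.le]) h'
  · intro j hj hne
    rw [Finset.mem_range] at hj
    refine if_neg fun ⟨c, hc⟩ ↦ hne ?_
    have hc2 : c < 2 := by
      by_contra hc2
      have := Nat.mul_le_mul_left p (not_lt.1 hc2)
      omega
    split_ifs <;> interval_cases c <;> omega
  · intro h
    exfalso
    apply h
    rw [Finset.mem_range]
    split_ifs <;> omega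

end OrbitModule

open OrbitModule

/-- An identification of the weight space of `M` at the point `1` with a complex vector space `W`
such that `X ^ p` acts on it by `F`. -/
structure Fiber (M : OrbitModule p) (W : Type) [AddCommGroup W] [Module ℂ W]
    (F : Module.End ℂ W) where
  /-- The inclusion of the weight space. -/
  incl : W →+ M.carrier
  /-- The projection to the weight space. -/
  proj : M.carrier →+ W
  smul_incl : ∀ (f : ℂ[T;T⁻¹]) w, f • incl w = incl (evalAt 1 f • w)
  proj_incl : ∀ w, proj (incl w) = w
  incl_proj : ∀ m, incl (proj m) = baseIdem p • m
  X_pow_smul_incl : ∀ w, GWA.X (sigma p) 1 ^ p • incl w = incl (F w)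

/-! ### Reconstruction of a weight module from its weight space at `1` and the monodromy. -/

namespace Fiber

variable {M N : OrbitModule p} {W W' : Type} [AddCommGroup W] [Module ℂ W] [AddCommGroup W']
  [Module ℂ W'] {F : Module.End ℂ W} {F' : Module.End ℂ W'}

theorem incl_injective (D : Fiber M W F) : Function.Injective D.incl :=
  Function.LeftInverse.injective D.proj_incl

theorem proj_smul (D : Fiber M W F) (f : ℂ[T;T⁻¹]) (m : M.carrier) :
    D.proj (f • m) = evalAt 1 f • D.proj m := by
  apply D.incl_injective
  rw [← D.smul_incl, D.incl_proj, D.incl_proj, smul_comm]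

theorem proj_X_pow_smul (D : Fiber M W F) (m : M.carrier) :
    D.proj (GWA.X (sigma p) 1 ^ p • m) = F (D.proj m) := by
  apply D.incl_injective
  rw [← D.X_pow_smul_incl, D.incl_proj, D.incl_proj, baseIdem_smul_X_pow_smul]

/-- `X^j` moves the weight space at `1` to the one at `q^j ≠ 1`, which the projection kills. -/
theorem proj_X_pow_smul_incl (D : Fiber M W F) {j : ℕ} (h0 : j ≠ 0) (hj : j < p) (w : W) :
    D.proj (GWA.X (sigma p) 1 ^ j • D.incl w) = 0 := by
  -- The polynomial is `baseIdem p` itself, written so that it can be moved past `X^j`. On one side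
  -- it acts by its value `0` at `q^j`, on the other by its value `1` at `1`.
  have h := D.proj_smul (scale ((rootQ p)⁻¹ ^ j) (scale (rootQ p ^ j) (baseIdem p)))
    (GWA.X (sigma p) 1 ^ j • D.incl w)
  rw [← M.X_pow_smul_smul, D.smul_incl, evalAt_scale, one_mul, evalAt_baseIdem,
    if_neg (Nat.not_dvd_of_pos_of_lt (Nat.pos_of_ne_zero h0) hj), zero_smul, map_zero, smul_zero,
    map_zero, ← RingAut.mul_apply, ← scale_mul, ← mul_pow, inv_mul_cancel, one_pow, scale_apply,
    scaleHom_one, RingHom.id_apply, evalAt_one_baseIdem, one_smul] at h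
  exact h.symm

theorem proj_Y_pow_smul_incl (D : Fiber M W F) {j : ℕ} (h0 : j ≠ 0) (hj : j < p) (w : W) :
    D.proj (GWA.Y (sigma p) 1 ^ j • D.incl w) = 0 := by
  have h := D.proj_smul (scale (rootQ p ^ j) (scale ((rootQ p)⁻¹ ^ j) (baseIdem p)))
    (GWA.Y (sigma p) 1 ^ j • D.incl w)
  -- `evalAt_baseIdem` takes natural exponents, so `q^(-j)` is rewritten as `q^(p-j)`.
  have e : (rootQ p)⁻¹ ^ j = rootQ p ^ (p - j) := by
    rw [inv_pow, inv_eq_iff_mul_eq_one, ← pow_add, Nat.add_sub_cancel' hj.le, rootQ_pow]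
  rw [← M.Y_pow_smul_smul, D.smul_incl, evalAt_scale, one_mul, e, evalAt_baseIdem,
    if_neg (Nat.not_dvd_of_pos_of_lt (by omega) (by omega)), zero_smul, map_zero, smul_zero,
    map_zero, ← e, ← RingAut.mul_apply, ← scale_mul, ← mul_pow, mul_inv_cancel, one_pow,
    scale_apply, scaleHom_one, RingHom.id_apply, evalAt_one_baseIdem, one_smul] at h
  exact h.symm

/-- The `j`-th coordinate of a vector is the projection of its translate by `X ^ j`. -/
def coords (D : Fiber M W F) : M.carrier ≃+ (Fin p → W) where
  toFun m j := D.proj (GWA.X (sigma p) 1 ^ (j : ℕ) • m)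
  invFun w := ∑ j : Fin p, GWA.Y (sigma p) 1 ^ (j : ℕ) • D.incl (w j)
  left_inv m := by
    simp only [D.incl_proj, Y_pow_smul_baseIdem_smul_X_pow_smul]
    rw [Fin.sum_univ_eq_sum_range fun j ↦ scale (rootQ p ^ j) (baseIdem p) • m]
    exact M.sum_scale_baseIdem_smul m
  right_inv w := funext fun i ↦ by
    dsimp only
    rw [Finset.smul_sum, map_sum, Finset.sum_eq_single i]
    · rw [← mul_smul, X_pow_mul_Y_pow, one_smul, D.proj_incl]
    -- For `i ≠ j` the product `X^i Y^j` collapses to a power of `X` or of `Y` with exponent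
    -- strictly between `0` and `p`, which the projection kills.
    · intro j _ hj
      have hj' : (j : ℕ) ≠ i := fun e ↦ hj (Fin.ext e)
      have := i.2
      have := j.2
      rw [← mul_smul]
      rcases lt_or_gt_of_ne hj' with h | h
      · obtain ⟨c, hc⟩ := Nat.exists_eq_add_of_lt h
        rw [show (i : ℕ) = (c + 1) + j by omega, pow_add, mul_assoc, X_pow_mul_Y_pow, mul_one]
        exact D.proj_X_pow_smul_incl (by omega) (by omega) _
      · obtain ⟨c, hc⟩ := Nat.exists_eq_add_of_lt h
        rw [show (j : ℕ) = i + (c + 1) by omega, pow_add, ← mul_assoc, X_pow_mul_Y_pow, one_mul]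
        exact D.proj_Y_pow_smul_incl (by omega) (by omega) _
    · simp
  map_add' m n := funext fun j ↦ by rw [smul_add, map_add]; rfl

theorem coords_apply (D : Fiber M W F) (m : M.carrier) (j : Fin p) :
    D.coords m j = D.proj (GWA.X (sigma p) 1 ^ (j : ℕ) • m) := rfl

theorem coords_smul (D : Fiber M W F) (f : ℂ[T;T⁻¹]) (m : M.carrier) (j : Fin p) :
    D.coords (f • m) j = evalAt 1 (scale ((rootQ p)⁻¹ ^ (j : ℕ)) f) • D.coords m j := by
  rw [coords_apply, X_pow_smul_smul, proj_smul, coords_apply]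

/-- `X` is a cyclic shift whose only nontrivial step is the wrap-around, where `X^p` contributes
`F`. The formula involves only `W` and `F`, hence `iso`. -/
theorem coords_X_smul (D : Fiber M W F) (m : M.carrier) (j : Fin p) :
    D.coords (GWA.X (sigma p) 1 • m) j =
      if h : (j : ℕ) + 1 < p then D.coords m ⟨j + 1, h⟩ else F (D.coords m 0) := by
  rw [coords_apply, ← mul_smul, ← pow_succ]
  split_ifs with h
  · rfl
  · have := j.2
    rw [show (j : ℕ) + 1 = p by omega, proj_X_pow_smul, coords_apply, Fin.val_zero, pow_zero,
      one_smul]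

/-- Two weight modules with the same fibre are isomorphic. -/
theorem iso (D : Fiber M W F) (E : Fiber N W F) : WeightModule.Iso M N := by
  have hX (m : M.carrier) : (D.coords.trans E.coords.symm) (GWA.X (sigma p) 1 • m) =
      GWA.X (sigma p) 1 • (D.coords.trans E.coords.symm) m := by
    apply E.coords.injective
    funext j
    rw [coords_X_smul]
    simp only [AddEquiv.trans_apply, AddEquiv.apply_symm_apply]
    exact coords_X_smul D m j
  refine WeightModule.Iso.of_addEquiv (D.coords.trans E.coords.symm) (fun f m ↦ ?_) hX fun m ↦ ?_
  · apply E.coords.injective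
    funext j
    rw [coords_smul]
    simp only [AddEquiv.trans_apply, AddEquiv.apply_symm_apply]
    exact coords_smul D f m j
  -- `Y` is the two-sided inverse of `X`, so compatibility with `X` is enough.
  · rw [← one_smul (GWA (sigma p) 1) ((D.coords.trans E.coords.symm) (GWA.Y (sigma p) 1 • m)),
      ← Y_mul_X, mul_smul, ← hX, ← mul_smul, X_mul_Y, one_smul]

/-- Transport of a fibre along an isomorphism of weight modules. -/
def ofIso (D : Fiber M W F) (e : M.carrier ≃ₗ[GWA (sigma p) 1] N.carrier) : Fiber N W F where
  incl := (e : M.carrier →+ N.carrier).comp D.incl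
  proj := D.proj.comp (e.symm : N.carrier →+ M.carrier)
  smul_incl f w := by
    change f • e (D.incl w) = e (D.incl _)
    rw [← D.smul_incl, WeightModule.equiv_smul]
  proj_incl w := by
    change D.proj (e.symm (e (D.incl w))) = w
    rw [e.symm_apply_apply, D.proj_incl]
  incl_proj m := by
    change e (D.incl (D.proj (e.symm m))) = _
    rw [D.incl_proj, WeightModule.equiv_smul, e.apply_symm_apply]
  X_pow_smul_incl w := by
    change _ • e (D.incl w) = e (D.incl _)
    rw [← D.X_pow_smul_incl, map_smul]

/-- Transport of a fibre along an isomorphism of vector spaces with endomorphisms. -/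
def conj (D : Fiber M W F) (e : W ≃ₗ[ℂ] W') (h : ∀ w, e (F w) = F' (e w)) : Fiber M W' F' where
  incl := D.incl.comp (e.symm : W' →+ W)
  proj := (e : W →+ W').comp D.proj
  smul_incl f w := by
    change f • D.incl (e.symm w) = D.incl (e.symm _)
    rw [D.smul_incl, map_smul e.symm]
  proj_incl w := by
    change e (D.proj (D.incl (e.symm w))) = w
    rw [D.proj_incl, e.apply_symm_apply]
  incl_proj m := by
    change D.incl (e.symm (e (D.proj m))) = _
    rw [e.symm_apply_apply, D.incl_proj]
  X_pow_smul_incl w := by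
    change _ • D.incl (e.symm w) = D.incl (e.symm _)
    rw [D.X_pow_smul_incl]
    congr 1
    rw [← e.symm_apply_apply (F _), h, e.apply_symm_apply]

/-- The fibre of a direct sum. -/
def directSum (D : Fiber M W F) (E : Fiber N W' F') :
    Fiber (M.directSum N) (W × W') (F.prodMap F') where
  incl := D.incl.prodMap E.incl
  proj := D.proj.prodMap E.proj
  smul_incl f w := Prod.ext (D.smul_incl f w.1) (E.smul_incl f w.2)
  proj_incl w := Prod.ext (D.proj_incl w.1) (E.proj_incl w.2)
  incl_proj m := Prod.ext (D.incl_proj m.1) (E.incl_proj m.2)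
  X_pow_smul_incl w := Prod.ext (D.X_pow_smul_incl w.1) (E.X_pow_smul_incl w.2)

/-- The fibre of the zero module. -/
def zero [Subsingleton W] (F : Module.End ℂ W) :
    Fiber (WeightModule.zero (sigma p) 1 (orbit p)) W F where
  incl := 0
  proj := 0
  smul_incl _ _ := rfl
  proj_incl _ := Subsingleton.elim _ _
  incl_proj _ := rfl
  X_pow_smul_incl _ := rfl

/-! ### Tensor products over the Laurent ring become tensor products of fibres over `ℂ`. -/

open WeightModule in
theorem X_pow_smul_tmul (j : ℕ) (m : M.carrier) (n : N.carrier) :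
    GWA.X (sigma p) 1 ^ j • tmul M N (one_mul 1) m n =
      tmul M N (one_mul 1) (GWA.X (sigma p) 1 ^ j • m) (GWA.X (sigma p) 1 ^ j • n) := by
  induction j with
  | zero => simp
  | succ j ih => rw [pow_succ', mul_smul, ih, X_smul_tmul, mul_smul, mul_smul]

/-- The inclusion of the tensor product of two fibres. -/
def tensorIncl (D : Fiber M W F) (E : Fiber N W' F') :
    W ⊗[ℂ] W' →+ M.carrier ⊗[ℂ[T;T⁻¹]] N.carrier :=
  TensorProduct.liftAddHom
    (AddMonoidHom.mk' (fun w ↦ AddMonoidHom.mk' (fun w' ↦ D.incl w ⊗ₜ E.incl w')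
      fun _ _ ↦ by rw [map_add, TensorProduct.tmul_add])
      fun _ _ ↦ AddMonoidHom.ext fun _ ↦ by simp [TensorProduct.add_tmul])
    -- The map is balanced over `ℂ` because a scalar acts on the fibre as the constant Laurent
    -- polynomial `C c`, which crosses the tensor sign over `R`.
    fun c w w' ↦ by
      have h1 := D.smul_incl (C c) w
      have h2 := E.smul_incl (C c) w'
      rw [evalAt_C] at h1 h2
      simp only [AddMonoidHom.mk'_apply, ← h1, ← h2, TensorProduct.smul_tmul]

theorem tensorIncl_tmul (D : Fiber M W F) (E : Fiber N W' F') (w : W) (w' : W') :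
    D.tensorIncl E (w ⊗ₜ w') = D.incl w ⊗ₜ E.incl w' := rfl

/-- The projection to the tensor product of two fibres. -/
def tensorProj (D : Fiber M W F) (E : Fiber N W' F') :
    M.carrier ⊗[ℂ[T;T⁻¹]] N.carrier →+ W ⊗[ℂ] W' :=
  TensorProduct.liftAddHom
    (AddMonoidHom.mk' (fun w ↦ AddMonoidHom.mk' (fun w' ↦ D.proj w ⊗ₜ E.proj w')
      fun _ _ ↦ by rw [map_add, TensorProduct.tmul_add])
      fun _ _ ↦ AddMonoidHom.ext fun _ ↦ by simp [TensorProduct.add_tmul])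
    fun f m n ↦ by
      simp only [AddMonoidHom.mk'_apply, D.proj_smul, E.proj_smul, TensorProduct.smul_tmul]

theorem tensorProj_tmul (D : Fiber M W F) (E : Fiber N W' F') (m : M.carrier) (n : N.carrier) :
    D.tensorProj E (m ⊗ₜ n) = D.proj m ⊗ₜ E.proj n := rfl

theorem smul_tensorIncl (D : Fiber M W F) (E : Fiber N W' F') (f : ℂ[T;T⁻¹]) (x : W ⊗[ℂ] W') :
    f • D.tensorIncl E x = D.tensorIncl E (evalAt 1 f • x) := by
  induction x using TensorProduct.induction_on with
  | zero => simp only [smul_zero, map_zero]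
  | tmul w w' =>
    rw [tensorIncl_tmul, TensorProduct.smul_tmul', D.smul_incl, TensorProduct.smul_tmul',
      tensorIncl_tmul]
  | add x y hx hy => rw [map_add, smul_add, hx, hy, smul_add, map_add]

theorem tensorProj_tensorIncl (D : Fiber M W F) (E : Fiber N W' F') (x : W ⊗[ℂ] W') :
    D.tensorProj E (D.tensorIncl E x) = x := by
  induction x using TensorProduct.induction_on with
  | zero => simp only [map_zero]
  | tmul w w' => rw [tensorIncl_tmul, tensorProj_tmul, D.proj_incl, E.proj_incl]
  | add x y hx hy => rw [map_add, map_add, hx, hy]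

theorem tensorIncl_tensorProj (D : Fiber M W F) (E : Fiber N W' F')
    (x : M.carrier ⊗[ℂ[T;T⁻¹]] N.carrier) :
    D.tensorIncl E (D.tensorProj E x) = baseIdem p • x := by
  induction x using TensorProduct.induction_on with
  | zero => simp only [map_zero, smul_zero]
  | tmul m n =>
    -- One idempotent per factor: both are moved to the left factor, where they merge into one.
    rw [tensorProj_tmul, tensorIncl_tmul, D.incl_proj, E.incl_proj, ← TensorProduct.smul_tmul,
      baseIdem_smul_baseIdem_smul, TensorProduct.smul_tmul']
  | add x y hx hy => rw [map_add, map_add, hx, hy, smul_add]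

theorem X_pow_smul_tensorIncl (D : Fiber M W F) (E : Fiber N W' F') (x : W ⊗[ℂ] W') :
    (GWA.X (sigma p) 1 ^ p • (show (M.tensor N (one_mul 1)).carrier from D.tensorIncl E x)) =
      D.tensorIncl E (TensorProduct.map F F' x) := by
  induction x using TensorProduct.induction_on with
  | zero => rw [map_zero, map_zero, map_zero]; exact smul_zero (A := (M.tensor N (one_mul 1)).carrier) _
  | tmul w w' =>
    refine (X_pow_smul_tmul p (D.incl w) (E.incl w')).trans ?_
    rw [D.X_pow_smul_incl, E.X_pow_smul_incl]
    rfl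
  | add x y hx hy =>
    rw [map_add, map_add, map_add]
    exact (smul_add _ _ _).trans (congrArg₂ (· + ·) hx hy)

/-- The fibre of a tensor product. -/
def tensor (D : Fiber M W F) (E : Fiber N W' F') :
    Fiber (M.tensor N (one_mul 1)) (W ⊗[ℂ] W') (TensorProduct.map F F') where
  incl := D.tensorIncl E
  proj := D.tensorProj E
  smul_incl := D.smul_tensorIncl E
  proj_incl := D.tensorProj_tensorIncl E
  incl_proj := D.tensorIncl_tensorProj E
  X_pow_smul_incl := D.X_pow_smul_tensorIncl E

end Fiber

namespace Fiber

/-- `Y^p` undoes `X^p`. This is what excludes the eigenvalue `0` in the block decomposition. -/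
theorem injective {M : OrbitModule p} {W : Type} [AddCommGroup W] [Module ℂ W]
    {F : Module.End ℂ W} (D : Fiber M W F) : Function.Injective F := by
  refine (injective_iff_map_eq_zero F).2 fun w hw ↦ D.incl_injective ?_
  have h := D.X_pow_smul_incl w
  rw [hw, map_zero] at h
  rw [map_zero, ← one_smul (GWA (sigma p) 1) (D.incl w), ← Y_pow_mul_X_pow p, mul_smul, h,
    smul_zero]

end Fiber

/-! ### Existence of fibres -/

/-- The weight space of `M` at the point `1`. -/
def FiberSpace (M : OrbitModule p) : Type :=
  LinearMap.range (LinearMap.lsmul ℂ[T;T⁻¹] M.carrier (baseIdem p))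

namespace FiberSpace

variable (M : OrbitModule p)

instance : AddCommGroup (FiberSpace M) :=
  inferInstanceAs (AddCommGroup (LinearMap.range (LinearMap.lsmul ℂ[T;T⁻¹] M.carrier (baseIdem p))))

instance : Module ℂ[T;T⁻¹] (FiberSpace M) :=
  inferInstanceAs
    (Module ℂ[T;T⁻¹] (LinearMap.range (LinearMap.lsmul ℂ[T;T⁻¹] M.carrier (baseIdem p))))

instance : Module ℂ (FiberSpace M) := Module.compHom _ (C : ℂ →+* ℂ[T;T⁻¹])

/-- The inclusion of the weight space. -/
def val : FiberSpace M →ₗ[ℂ[T;T⁻¹]] M.carrier := Submodule.subtype _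

theorem val_injective : Function.Injective (val M) := Subtype.val_injective

theorem val_smul (c : ℂ) (w : FiberSpace M) : val M (c • w) = C c • val M w := rfl

/-- The projection to the weight space. -/
def proj : M.carrier →ₗ[ℂ[T;T⁻¹]] FiberSpace M := LinearMap.rangeRestrict _

theorem val_proj (m : M.carrier) : val M (proj M m) = baseIdem p • m := rfl

theorem proj_surjective : Function.Surjective (proj M) := LinearMap.surjective_rangeRestrict _

theorem proj_val (w : FiberSpace M) : proj M (val M w) = w := by
  obtain ⟨m, rfl⟩ := proj_surjective M w
  exact val_injective M (by rw [val_proj, val_proj, baseIdem_smul_baseIdem_smul])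

theorem smul_eq (f : ℂ[T;T⁻¹]) (w : FiberSpace M) : f • w = evalAt 1 f • w := by
  obtain ⟨m, rfl⟩ := proj_surjective M w
  apply val_injective M
  rw [val_smul, map_smul, val_proj, smul_baseIdem_smul]

theorem baseIdem_smul_val (w : FiberSpace M) : baseIdem p • val M w = val M w := by
  rw [← val_proj, proj_val]

/-- The action of `X ^ p` on the weight space. -/
def monodromy : Module.End ℂ (FiberSpace M) where
  toFun w := proj M (GWA.X (sigma p) 1 ^ p • val M w)
  map_add' v w := by rw [map_add, smul_add, map_add]
  map_smul' c w := by
    rw [RingHom.id_apply, val_smul, X_pow_smul_smul, inv_pow, rootQ_pow, inv_one, scale_C,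
      map_smul, smul_eq, evalAt_C]

/-- The weight space is a fibre. -/
def fiber : Fiber M (FiberSpace M) (monodromy M) where
  incl := (val M).toAddMonoidHom
  proj := (proj M).toAddMonoidHom
  smul_incl f w := by
    refine ((val M).map_smul f w).symm.trans ?_
    rw [smul_eq]
    rfl
  proj_incl := proj_val M
  incl_proj := val_proj M
  X_pow_smul_incl w := by
    change _ • val M w = val M (proj M (_ • val M w))
    rw [val_proj, baseIdem_smul_X_pow_smul, baseIdem_smul_val]

/-- `R` acts on the weight space by evaluation at `1`, so generators over `R` are generators over
`ℂ`. -/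
instance : Module.Finite ℂ (FiberSpace M) := by
  have := M.isWeight.moduleFinite (orbit p).finite
  have : Module.Finite ℂ[T;T⁻¹] (FiberSpace M) := Module.Finite.of_surjective _ (proj_surjective M)
  obtain ⟨s, hs⟩ := (Module.Finite.fg_top : (⊤ : Submodule ℂ[T;T⁻¹] (FiberSpace M)).FG)
  refine ⟨s, eq_top_iff.2 fun w _ ↦ ?_⟩
  have hw : w ∈ Submodule.span ℂ[T;T⁻¹] (s : Set (FiberSpace M)) := hs ▸ Submodule.mem_top
  induction hw using Submodule.span_induction with
  | mem w hw => exact Submodule.subset_span hw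
  | zero => exact Submodule.zero_mem _
  | add v w _ _ hv hw => exact Submodule.add_mem _ (hv trivial) (hw trivial)
  | smul f w _ hw => rw [smul_eq]; exact Submodule.smul_mem _ _ (hw trivial)

end FiberSpace

/-! ### The fibres of the modules attached to invertible matrices -/

theorem add_one_eq_zero_iff (k : Fin p) : k + 1 = 0 ↔ p ∣ (k : ℕ) + 1 := by
  rw [Fin.ext_iff, Fin.val_add, Fin.val_one', Nat.add_mod_mod, Fin.val_zero,
    Nat.dvd_iff_mod_eq_zero]

/-- Index `k` carries the weight `q^(k+1)`, so the weight `1` sits at the last index, which is `-1`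
in `Fin p`. -/
theorem eq_neg_one_iff (k : Fin p) : k = -1 ↔ p ∣ (k : ℕ) + 1 := by
  rw [← add_one_eq_zero_iff, eq_neg_iff_add_eq_zero]

namespace CircleSpace

variable {d : ℕ}

/-- The vector concentrated in the `i`-th summand. -/
def single {p : ℕ} (i : Fin p) : (Fin d → ℂ) →+ CircleSpace p d :=
  AddMonoidHom.mk' (fun w k ↦ if k = i then w else 0) fun v w ↦ funext fun k ↦ by
    change _ = (if k = i then v else 0) + (if k = i then w else 0)
    split_ifs <;> simp

theorem single_apply {p : ℕ} (i k : Fin p) (w : Fin d → ℂ) :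
    single i w k = if k = i then w else 0 := rfl

theorem smul_single (f : ℂ[T;T⁻¹]) (w : Fin d → ℂ) :
    f • single (-1 : Fin p) w = single (-1) (evalAt 1 f • w) := by
  funext k
  rw [smul_apply, single_apply, single_apply]
  split_ifs with h
  · have h1 : weight p k = 1 :=
      ((rootQ_isPrimitiveRoot p).pow_eq_one_iff_dvd _).2 ((eq_neg_one_iff k).1 h)
    rw [h1]
  · exact smul_zero _

theorem single_eq_baseIdem_smul (v : CircleSpace p d) :
    single (-1) (v (-1)) = baseIdem p • v := by
  funext k
  rw [smul_apply, weight, evalAt_baseIdem, single_apply]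
  by_cases h : k = -1
  · rw [if_pos h, if_pos ((eq_neg_one_iff k).1 h), h, one_smul]
  · rw [if_neg h, if_neg fun e ↦ h ((eq_neg_one_iff k).2 e), zero_smul]

open Matrix in
theorem actX_single (F : GL (Fin d) ℂ) (i : Fin p) (w : Fin d → ℂ) :
    actX F (single i w) = single (i + 1) (if i + 1 = 0 then F.1 *ᵥ w else w) := by
  funext k
  rw [actX_apply, single_apply, single_apply]
  by_cases h : k = i + 1
  · subst h
    simp
  · have h' : k - 1 ≠ i := fun e ↦ h (by rw [← e, sub_add_cancel])
    simp [h, h']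

theorem X_smul (F : GL (Fin d) ℂ) (v : CircleSpace p d) :
    GWA.X (sigma p) 1 • (show (circleModule p F).carrier from v) = actX F v :=
  WeightModule.of_X_smul ..

-- `F` enters at the very first step, from the last index to `0`; the later steps stay below `p` and
-- are plain shifts.
open Matrix in
theorem X_pow_succ_smul_single (F : GL (Fin d) ℂ) (w : Fin d → ℂ) (j : ℕ) (hj : j < p) :
    GWA.X (sigma p) 1 ^ (j + 1) • (show (circleModule p F).carrier from single (-1) w) =
      single ⟨j, hj⟩ (F.1 *ᵥ w) := by
  induction j with
  | zero =>
    rw [zero_add, pow_one]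
    refine (X_smul F _).trans ?_
    rw [actX_single, neg_add_cancel, if_pos rfl]
    rfl
  | succ j ih =>
    rw [pow_succ', mul_smul, ih (by omega)]
    refine (X_smul F _).trans ?_
    have h : (⟨j, by omega⟩ : Fin p) + 1 = ⟨j + 1, hj⟩ := by
      refine Fin.ext ?_
      rw [Fin.val_add, Fin.val_one', Nat.add_mod_mod, Nat.mod_eq_of_lt hj]
    rw [actX_single, h, if_neg]
    exact fun e ↦ absurd (Fin.ext_iff.1 e) (Nat.succ_ne_zero j)

end CircleSpace

open Matrix in
/-- The fibre of the module attached to an invertible matrix. -/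
def circleFiber {d : ℕ} (F : GL (Fin d) ℂ) :
    Fiber (circleModule p F) (Fin d → ℂ) (Matrix.toLin' F.1) where
  incl := CircleSpace.single (-1)
  proj := AddMonoidHom.mk' (fun v : CircleSpace p d ↦ v (-1)) fun _ _ ↦ rfl
  smul_incl := CircleSpace.smul_single
  proj_incl w := if_pos rfl
  incl_proj := CircleSpace.single_eq_baseIdem_smul
  X_pow_smul_incl w := by
    have hp := Nat.pos_of_ne_zero (NeZero.ne p)
    have h := CircleSpace.X_pow_succ_smul_single (p := p) F w (p - 1) (by omega)
    have e : (⟨p - 1, by omega⟩ : Fin p) = -1 :=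
      (eq_neg_one_iff _).2 (by rw [Nat.sub_add_cancel hp])
    rw [Nat.sub_add_cancel hp, e] at h
    exact h

end SkewLaurent

end

noncomputable section

open TensorProduct

namespace SkewLaurent

open OrbitModule Polynomial

variable {p : ℕ} [NeZero p]

/-! ### Vector spaces with an endomorphism -/

/-- Needed for isomorphisms of operators and for the two projections of a product. -/
theorem aeval_intertwine {W W' : Type} [AddCommGroup W] [Module ℂ W] [AddCommGroup W']
    [Module ℂ W'] {F : Module.End ℂ W} {F' : Module.End ℂ W'} (e : W →ₗ[ℂ] W')
    (h : ∀ w, e (F w) = F' (e w)) (g : ℂ[X]) (w : W) : e (aeval F g w) = aeval F' g (e w) := by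
  have hpow (n : ℕ) (w : W) : e ((F ^ n) w) = (F' ^ n) (e w) := by
    induction n generalizing w with
    | zero => rfl
    | succ n ih => rw [pow_succ, pow_succ, Module.End.mul_apply, Module.End.mul_apply, ih, h]
  induction g using Polynomial.induction_on' with
  | add g g' hg hg' =>
    rw [map_add, map_add, LinearMap.add_apply, LinearMap.add_apply, map_add, hg, hg']
  | monomial n a => simp [aeval_monomial, hpow]

/-- The dimension of the range of `g(F)`. -/
def polyRank {W : Type} [AddCommGroup W] [Module ℂ W] (F : Module.End ℂ W) (g : ℂ[X]) : ℕ :=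
  Module.finrank ℂ (LinearMap.range (aeval F g))

theorem polyRank_congr {W W' : Type} [AddCommGroup W] [Module ℂ W] [AddCommGroup W']
    [Module ℂ W'] {F : Module.End ℂ W} {F' : Module.End ℂ W'} (e : W ≃ₗ[ℂ] W')
    (h : ∀ w, e (F w) = F' (e w)) (g : ℂ[X]) : polyRank F g = polyRank F' g := by
  have hr : (LinearMap.range (aeval F g)).map (e : W →ₗ[ℂ] W') = LinearMap.range (aeval F' g) := by
    ext w
    constructor
    · rintro ⟨_, ⟨v, rfl⟩, rfl⟩
      exact ⟨e v, (aeval_intertwine (e : W →ₗ[ℂ] W') h g v).symm⟩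
    · rintro ⟨v, rfl⟩
      refine ⟨_, ⟨e.symm v, rfl⟩, (aeval_intertwine (e : W →ₗ[ℂ] W') h g _).trans ?_⟩
      simp
  rw [polyRank, polyRank, ← hr]
  exact (LinearEquiv.finrank_map_eq e _).symm

theorem polyRank_prodMap {W W' : Type} [AddCommGroup W] [Module ℂ W] [AddCommGroup W']
    [Module ℂ W'] [Module.Finite ℂ W] [Module.Finite ℂ W'] (F : Module.End ℂ W)
    (F' : Module.End ℂ W') (g : ℂ[X]) :
    polyRank (F.prodMap F') g = polyRank F g + polyRank F' g := by
  have h : aeval (F.prodMap F') g = (aeval F g).prodMap (aeval F' g) := LinearMap.ext fun w ↦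
    Prod.ext (aeval_intertwine (F := F.prodMap F') (LinearMap.fst ℂ W W') (fun _ ↦ rfl) g w)
      (aeval_intertwine (F := F.prodMap F') (LinearMap.snd ℂ W W') (fun _ ↦ rfl) g w)
  rw [polyRank, polyRank, polyRank, h, LinearMap.range_prodMap, ← Module.finrank_prod]
  exact LinearEquiv.finrank_eq
    { toFun := fun x ↦ (⟨x.1.1, x.2.1⟩, ⟨x.1.2, x.2.2⟩)
      invFun := fun x ↦ ⟨(x.1.1, x.2.1), ⟨x.1.2, x.2.2⟩⟩
      map_add' := fun _ _ ↦ rfl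
      map_smul' := fun _ _ ↦ rfl
      left_inv := fun _ ↦ rfl
      right_inv := fun _ ↦ rfl }

theorem polyRank_eq_zero_iff {W : Type} [AddCommGroup W] [Module ℂ W] [Module.Finite ℂ W]
    (F : Module.End ℂ W) (g : ℂ[X]) : polyRank F g = 0 ↔ aeval F g = 0 := by
  rw [polyRank, Submodule.finrank_eq_zero, LinearMap.range_eq_bot]

/-! ### Cyclic modules over the polynomial ring -/

/-- The cyclic module defined by a polynomial. -/
abbrev Cyclic (f : ℂ[X]) : Type := ℂ[X] ⧸ Ideal.span {f}

/-- Multiplication by the variable on a cyclic module. -/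
def mulVar (f : ℂ[X]) : Module.End ℂ (Cyclic f) := Algebra.lmul ℂ (Cyclic f) (Ideal.Quotient.mk _ X)

theorem aeval_lmul {A : Type} [CommRing A] [Algebra ℂ A] (a : A) (g : ℂ[X]) :
    aeval (Algebra.lmul ℂ A a) g = Algebra.lmul ℂ A (aeval a g) :=
  aeval_algHom_apply (Algebra.lmul ℂ A) a g

theorem lmul_eq_zero_iff {A : Type} [CommRing A] [Algebra ℂ A] (a : A) :
    Algebra.lmul ℂ A a = 0 ↔ a = 0 :=
  ⟨fun h ↦ by simpa using LinearMap.congr_fun h 1, fun h ↦ by rw [h, map_zero]⟩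

theorem aeval_mk_X (f g : ℂ[X]) :
    aeval (Ideal.Quotient.mk (Ideal.span {f}) X) g = Ideal.Quotient.mk _ g := by
  have h := aeval_algHom_apply (Ideal.Quotient.mkₐ ℂ (Ideal.span {f})) X g
  rwa [aeval_X_left_apply] at h

theorem aeval_mulVar (f g : ℂ[X]) :
    aeval (mulVar f) g = Algebra.lmul ℂ (Cyclic f) (Ideal.Quotient.mk _ g) := by
  rw [mulVar, aeval_lmul, aeval_mk_X]

/-- `g` of the operator is multiplication by the class of `g`, which vanishes as soon as it kills
`1`. -/
theorem aeval_mulVar_eq_zero_iff (f g : ℂ[X]) : aeval (mulVar f) g = 0 ↔ f ∣ g := by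
  rw [aeval_mulVar, lmul_eq_zero_iff, Ideal.Quotient.eq_zero_iff_mem, Ideal.mem_span_singleton]

theorem mk_isUnit_of_isCoprime {f g : ℂ[X]} (h : IsCoprime g f) :
    IsUnit (Ideal.Quotient.mk (Ideal.span {f}) g) := by
  obtain ⟨a, b, hab⟩ := h
  refine IsUnit.of_mul_eq_one (Ideal.Quotient.mk _ a) ?_
  rw [← map_mul, ← map_one (Ideal.Quotient.mk _), Ideal.Quotient.eq, Ideal.mem_span_singleton]
  exact ⟨-b, by linear_combination hab⟩

/-- `g` is a unit modulo `f`, so multiplication by it is onto. -/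
theorem polyRank_mulVar_of_isCoprime {f g : ℂ[X]} (h : IsCoprime g f) :
    polyRank (mulVar f) g = Module.finrank ℂ (Cyclic f) := by
  have hu := mk_isUnit_of_isCoprime h
  have hr : LinearMap.range (aeval (mulVar f) g) = ⊤ := by
    rw [aeval_mulVar, LinearMap.range_eq_top]
    intro x
    obtain ⟨y, hy⟩ := hu.dvd (a := x)
    exact ⟨y, hy.symm⟩
  rw [polyRank, hr, finrank_top]

theorem cyclic_finite {f : ℂ[X]} (hf : f.Monic) : Module.Finite ℂ (Cyclic f) :=
  (AdjoinRoot.powerBasis' hf).finite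

/-- The companion matrix is the matrix of multiplication by the root in the power basis of
`ℂ[X]/(f)`. -/
theorem exists_companion_equiv {f : ℂ[X]} (hf : f.Monic) :
    ∃ e : (Fin f.natDegree → ℂ) ≃ₗ[ℂ] Cyclic f,
      ∀ w, e (Matrix.toLin' (companion f) w) = mulVar f (e w) := by
  let B := AdjoinRoot.powerBasis' hf
  have hm : B.minpolyGen = f := by
    rw [PowerBasis.minpolyGen_eq]
    have h := AdjoinRoot.minpoly_powerBasis_gen_of_monic hf
    exact h
  have hc : Algebra.leftMulMatrix B.basis B.gen = companion f := by
    rw [PowerBasis.leftMulMatrix, hm]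
    ext i j
    simp only [companion, Matrix.of_apply, hf.leadingCoeff, div_one]
    rfl
  have key (w : Fin B.dim → ℂ) : B.basis.equivFun.symm
      ((Algebra.leftMulMatrix B.basis B.gen).mulVec w) = B.gen * B.basis.equivFun.symm w := by
    apply B.basis.equivFun.injective
    rw [LinearEquiv.apply_symm_apply]
    have h := Algebra.leftMulMatrix_mulVec_repr B.basis B.gen (B.basis.equivFun.symm w)
    rwa [← Module.Basis.equivFun_apply, ← Module.Basis.equivFun_apply,
      LinearEquiv.apply_symm_apply] at h
  rw [hc] at key
  exact ⟨B.basis.equivFun.symm, key⟩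

theorem exists_cyclic_X_sub_C_equiv {f : ℂ[X]} {a : ℂ} (hf : f = X - C a) :
    ∃ e : Cyclic f ≃ₗ[ℂ] ℂ, ∀ w, e (mulVar f w) = a * e w := by
  subst hf
  refine ⟨(quotientSpanXSubCAlgEquiv a).toLinearEquiv, fun w ↦ ?_⟩
  refine (map_mul (quotientSpanXSubCAlgEquiv a) (Ideal.Quotient.mk _ X) w).trans ?_
  rw [quotientSpanXSubCAlgEquiv_mk, eval_X]
  rfl

/-! ### The modules attached to companion matrices -/

variable (p) in
/-- The isomorphism class of the module attached to the companion matrix of `(x - ξ) ^ a`. -/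
def block (ξ : ℂˣ) (a : ℕ) : IsoClass (orbit p) :=
  IsoClass.mk (circleModule p (companion_isUnit (coeff_zero_ne ξ a)).unit)

/-- The fibre of a representative of an isomorphism class of weight modules. -/
def HasFiber (c : IsoClass (orbit p)) {W : Type} [AddCommGroup W] [Module ℂ W]
    (F : Module.End ℂ W) : Prop :=
  ∃ M : OrbitModule p, IsoClass.mk M = c ∧ Nonempty (Fiber M W F)

namespace HasFiber

variable {c c' : IsoClass (orbit p)} {W W' : Type} [AddCommGroup W] [Module ℂ W]
  [AddCommGroup W'] [Module ℂ W'] {F : Module.End ℂ W} {F' : Module.End ℂ W'}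

/-- The tool for identities between classes: exhibit the same operator as a fibre of both sides. -/
theorem unique (h : HasFiber c F) (h' : HasFiber c' F) : c = c' := by
  obtain ⟨M, rfl, ⟨D⟩⟩ := h
  obtain ⟨N, rfl, ⟨E⟩⟩ := h'
  exact IsoClass.mk_eq_mk.2 (D.iso E)

theorem conj (h : HasFiber c F) (e : W ≃ₗ[ℂ] W') (he : ∀ w, e (F w) = F' (e w)) :
    HasFiber c F' := by
  obtain ⟨M, rfl, ⟨D⟩⟩ := h
  exact ⟨M, rfl, ⟨D.conj e he⟩⟩

theorem add (h : HasFiber c F) (h' : HasFiber c' F') : HasFiber (c + c') (F.prodMap F') := by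
  obtain ⟨M, rfl, ⟨D⟩⟩ := h
  obtain ⟨N, rfl, ⟨E⟩⟩ := h'
  exact ⟨M.directSum N, rfl, ⟨D.directSum E⟩⟩

theorem mul (h : HasFiber c F) (h' : HasFiber c' F') :
    HasFiber (c * c') (TensorProduct.map F F') := by
  obtain ⟨M, rfl, ⟨D⟩⟩ := h
  obtain ⟨N, rfl, ⟨E⟩⟩ := h'
  exact ⟨M.tensor N (one_mul 1), rfl, ⟨D.tensor E⟩⟩

theorem zero [Subsingleton W] (F : Module.End ℂ W) : HasFiber (0 : IsoClass (orbit p)) F :=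
  ⟨_, rfl, ⟨Fiber.zero F⟩⟩

theorem sum {n : ℕ} {c : Fin n → IsoClass (orbit p)} {W : Fin n → Type}
    [∀ i, AddCommGroup (W i)] [∀ i, Module ℂ (W i)] {F : ∀ i, Module.End ℂ (W i)}
    (h : ∀ i, HasFiber (c i) (F i)) :
    HasFiber (∑ i, c i) (LinearMap.pi fun i ↦ F i ∘ₗ LinearMap.proj i) := by
  induction n with
  | zero => rw [Fin.sum_univ_zero]; exact zero _
  | succ n ih =>
    rw [Fin.sum_univ_succ]
    refine ((h 0).add (ih fun i ↦ h i.succ)).conj (Fin.consLinearEquiv ℂ W) fun w ↦ ?_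
    funext i
    cases i using Fin.cases <;> rfl

end HasFiber

theorem block_hasFiber (ξ : ℂˣ) (a : ℕ) :
    HasFiber (block p ξ a) (mulVar ((X - C (ξ : ℂ)) ^ a)) := by
  obtain ⟨e, he⟩ := exists_companion_equiv ((monic_X_sub_C (ξ : ℂ)).pow a)
  exact ⟨_, rfl, ⟨(circleFiber _).conj e he⟩⟩

theorem block_one_hasFiber (ξ : ℂˣ) :
    HasFiber (block p ξ 1) (Algebra.lmul ℂ ℂ (ξ : ℂ)) := by
  obtain ⟨e, he⟩ := exists_cyclic_X_sub_C_equiv (pow_one (X - C (ξ : ℂ)))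
  exact (block_hasFiber ξ 1).conj e he

/-- Tensoring with a line leaves `W` unchanged and scales the monodromy. -/
theorem block_one_mul_hasFiber (ξ : ℂˣ) {c : IsoClass (orbit p)} {W : Type} [AddCommGroup W]
    [Module ℂ W] {F : Module.End ℂ W} (h : HasFiber c F) :
    HasFiber (block p ξ 1 * c) ((ξ : ℂ) • F) := by
  refine ((block_one_hasFiber ξ).mul h).conj (TensorProduct.lid ℂ W) fun w ↦ ?_
  induction w using TensorProduct.induction_on with
  | zero => simp
  | tmul a w => simp [mul_smul, smul_comm a]
  | add v w hv hw => rw [map_add, map_add, hv, hw, map_add, map_add]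

theorem exists_hasFiber (c : IsoClass (orbit p)) :
    ∃ M : OrbitModule p, HasFiber c (FiberSpace.monodromy M) := by
  induction c using Quotient.inductionOn with
  | h M => exact ⟨M, M, rfl, ⟨FiberSpace.fiber M⟩⟩

/-- Scaling the monodromy by `1` changes nothing, so this class is a multiplicative identity. The
fibre of the unit module need not be computed. -/
theorem block_one_one : block p 1 1 = 1 := by
  have h (c : IsoClass (orbit p)) : block p 1 1 * c = c := by
    obtain ⟨M, hM⟩ := exists_hasFiber c
    have h1 := block_one_mul_hasFiber 1 hM
    rw [Units.val_one, one_smul] at h1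
    exact h1.unique hM
  rw [← mul_one (block p 1 1), h]

theorem block_mul_block (ξ η : ℂˣ) : block p ξ 1 * block p η 1 = block p (ξ * η) 1 := by
  have h := block_one_mul_hasFiber ξ (block_one_hasFiber (p := p) η)
  rw [← map_smul, smul_eq_mul, ← Units.val_mul] at h
  exact h.unique (block_one_hasFiber _)

/-- Blocks of size `0` are harmless, so decompositions below may contain them. -/
theorem block_zero (ξ : ℂˣ) : block p ξ 0 = 0 := by
  have : Subsingleton (Cyclic ((X - C (ξ : ℂ)) ^ 0)) :=
    Ideal.Quotient.subsingleton_iff.2 (by rw [pow_zero, Ideal.span_singleton_one])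
  exact (block_hasFiber ξ 0).unique (HasFiber.zero _)

/-! ### Rank functions -/

/-- In both fibres inclusion after projection is the same idempotent, so crossing from one fibre to
the other and back is the identity. Invariants of `F` are therefore invariants of the module. -/
theorem Fiber.exists_equiv {M : OrbitModule p} {W W' : Type} [AddCommGroup W] [Module ℂ W]
    [AddCommGroup W'] [Module ℂ W'] {F : Module.End ℂ W} {F' : Module.End ℂ W'} (D : Fiber M W F)
    (E : Fiber M W' F') : ∃ e : W ≃ₗ[ℂ] W', ∀ w, e (F w) = F' (e w) := by
  have hb {W W' : Type} [AddCommGroup W] [Module ℂ W] [AddCommGroup W'] [Module ℂ W']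
      {F : Module.End ℂ W} {F' : Module.End ℂ W'} (D : Fiber M W F) (E : Fiber M W' F') (w : W) :
      D.proj (E.incl (E.proj (D.incl w))) = w := by
    rw [E.incl_proj, D.smul_incl, evalAt_one_baseIdem, one_smul, D.proj_incl]
  refine ⟨{ E.proj.comp D.incl with
    invFun := D.proj.comp E.incl
    left_inv := hb D E
    right_inv := hb E D
    map_smul' := fun c w ↦ ?_ }, fun w ↦ ?_⟩
  · change E.proj (D.incl (c • w)) = c • E.proj (D.incl w)
    have h := D.smul_incl (LaurentPolynomial.C c) w
    rw [evalAt_C] at h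
    rw [← h, E.proj_smul, evalAt_C]
  · change E.proj (D.incl (F w)) = F' (E.proj (D.incl w))
    rw [← D.X_pow_smul_incl, E.proj_X_pow_smul]

/-- The rank of `g` on the weight space at the point `1`, as a function of the isomorphism
class. -/
def classRank (g : ℂ[X]) (c : IsoClass (orbit p)) : ℕ :=
  Quotient.liftOn c (fun M ↦ polyRank (FiberSpace.monodromy M) g) fun M N ⟨e⟩ ↦ by
    obtain ⟨f, hf⟩ := ((FiberSpace.fiber M).ofIso e).exists_equiv (FiberSpace.fiber N)
    exact polyRank_congr f hf g

theorem HasFiber.classRank_eq {c : IsoClass (orbit p)} {W : Type} [AddCommGroup W] [Module ℂ W]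
    {F : Module.End ℂ W} (h : HasFiber c F) (g : ℂ[X]) : classRank g c = polyRank F g := by
  obtain ⟨M, rfl, ⟨D⟩⟩ := h
  obtain ⟨f, hf⟩ := (FiberSpace.fiber M).exists_equiv D
  exact polyRank_congr f hf g

theorem classRank_zero (g : ℂ[X]) : classRank g (0 : IsoClass (orbit p)) = 0 := by
  rw [(HasFiber.zero (W := PUnit) 0).classRank_eq, polyRank_eq_zero_iff]
  exact Subsingleton.elim _ _

theorem classRank_add (g : ℂ[X]) (c c' : IsoClass (orbit p)) :
    classRank g (c + c') = classRank g c + classRank g c' := by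
  obtain ⟨M, h⟩ := exists_hasFiber c
  obtain ⟨N, h'⟩ := exists_hasFiber c'
  rw [(h.add h').classRank_eq, h.classRank_eq, h'.classRank_eq, polyRank_prodMap]

variable (p) in
/-- The rank as an additive map. -/
def classRankHom (g : ℂ[X]) : IsoClass (orbit p) →+ ℕ where
  toFun := classRank g
  map_zero' := classRank_zero g
  map_add' := classRank_add g

theorem HasFiber.classRankHom_eq {c : IsoClass (orbit p)} {W : Type} [AddCommGroup W]
    [Module ℂ W] {F : Module.End ℂ W} (h : HasFiber c F) (g : ℂ[X]) :
    classRankHom p g c = polyRank F g := h.classRank_eq g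

theorem classRankHom_block_eq_zero_iff (g : ℂ[X]) (ξ : ℂˣ) (a : ℕ) :
    classRankHom p g (block p ξ a) = 0 ↔ (X - C (ξ : ℂ)) ^ a ∣ g := by
  have := cyclic_finite ((monic_X_sub_C (ξ : ℂ)).pow a)
  rw [(block_hasFiber ξ a).classRankHom_eq, polyRank_eq_zero_iff, aeval_mulVar_eq_zero_iff]

theorem isCoprime_X_sub_C_pow {ξ η : ℂˣ} (h : ξ ≠ η) (a b : ℕ) :
    IsCoprime ((X - C (ξ : ℂ)) ^ a) ((X - C (η : ℂ)) ^ b) :=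
  (isCoprime_X_sub_C_of_isUnit_sub
    (sub_ne_zero.2 fun e ↦ h (Units.ext e)).isUnit).pow

/-- The rank is full and independent of `k`; differences over `k` therefore vanish on blocks with
another eigenvalue. -/
theorem classRankHom_block_of_ne {ξ η : ℂˣ} (h : ξ ≠ η) (a k : ℕ) :
    classRankHom p ((X - C (ξ : ℂ)) ^ k) (block p η a) =
      Module.finrank ℂ (Cyclic ((X - C (η : ℂ)) ^ a)) := by
  rw [(block_hasFiber η a).classRankHom_eq,
    polyRank_mulVar_of_isCoprime (isCoprime_X_sub_C_pow h k a)]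

/-! ### Decomposition into blocks -/

/-- Over `ℂ` an irreducible polynomial is linear up to a unit, and injectivity of `X` rules out the
root `0`. -/
theorem exists_span_pow_eq {q : ℂ[X]} (hq : Irreducible q) (e : ℕ)
    (hX : ∀ w : ℂ[X] ⧸ Ideal.span {q ^ e}, (X : ℂ[X]) • w = 0 → w = 0) :
    ∃ (ξ : ℂˣ) (a : ℕ), Ideal.span {q ^ e} = Ideal.span {(X - C (ξ : ℂ)) ^ a} := by
  -- For `e = 0` the quotient is zero and the eigenvalue is arbitrary.
  rcases Nat.eq_zero_or_pos e with rfl | he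
  · exact ⟨1, 0, by rw [pow_zero, pow_zero]⟩
  obtain ⟨z, hz⟩ := IsAlgClosed.exists_root q hq.degree_pos.ne'
  have hass : Associated (X - C z) q :=
    (irreducible_X_sub_C z).associated_of_dvd hq (dvd_iff_isRoot.2 hz)
  have hspan : Ideal.span {q ^ e} = Ideal.span {(X - C z) ^ e} :=
    Ideal.span_singleton_eq_span_singleton.2 (hass.symm.pow_pow)
  have hz0 : z ≠ 0 := by
    rintro rfl
    rw [map_zero, sub_zero] at hspan
    rw [hspan] at hX
    -- If the root were `0`, the nonzero class of `X^(e-1)` would be killed by `X`.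
    have h := hX (Ideal.Quotient.mk _ (X ^ (e - 1))) (by
      rw [← Ideal.Quotient.mk_eq_mk, ← Submodule.Quotient.mk_smul, Ideal.Quotient.mk_eq_mk,
        Ideal.Quotient.eq_zero_iff_mem, smul_eq_mul, ← pow_succ', Nat.sub_add_cancel he]
      exact Ideal.subset_span rfl)
    rw [Ideal.Quotient.eq_zero_iff_mem, Ideal.mem_span_singleton,
      pow_dvd_pow_iff X_ne_zero not_isUnit_X] at h
    omega
  exact ⟨Units.mk0 z hz0, e, hspan⟩

/-- Every isomorphism class is a sum of blocks. -/
theorem exists_eq_sum_block (c : IsoClass (orbit p)) :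
    ∃ (n : ℕ) (ξ : Fin n → ℂˣ) (a : Fin n → ℕ), c = ∑ i, block p (ξ i) (a i) := by
  obtain ⟨M, hM⟩ := exists_hasFiber c
  set F := FiberSpace.monodromy M
  have hinj : Function.Injective F := (FiberSpace.fiber M).injective
  -- Structure theorem for torsion modules over `ℂ[X]`, with `X` acting as the monodromy.
  obtain ⟨ι, _, q, hq, e, ⟨φ⟩⟩ := Module.equiv_directSum_of_isTorsion
    (Module.AEval.isTorsion_of_finiteDimensional ℂ (FiberSpace M) F)
  classical
  let ψ := φ.trans ((DirectSum.linearEquivFunOnFintype ℂ[X] ι _).trans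
    (LinearEquiv.piCongrLeft' ℂ[X] (fun i ↦ ℂ[X] ⧸ Ideal.span {q i ^ e i}) (Fintype.equivFin ι)))
  -- Injectivity of `F` passes to each summand, by placing `w` in slot `j` and transporting it back.
  have hX (j : Fin (Fintype.card ι))
      (w : ℂ[X] ⧸ Ideal.span {q ((Fintype.equivFin ι).symm j) ^ e ((Fintype.equivFin ι).symm j)})
      (hw : (X : ℂ[X]) • w = 0) : w = 0 := by
    have h1 : (X : ℂ[X]) • ψ.symm (Pi.single j w) = 0 := by
      rw [← map_smul, ← Pi.single_smul, hw, Pi.single_zero, map_zero]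
    have h2 : F ((Module.AEval'.of F).symm (ψ.symm (Pi.single j w))) = 0 := by
      apply (Module.AEval'.of F).injective
      rw [← Module.AEval'.X_smul_of, LinearEquiv.apply_symm_apply, h1, map_zero]
    have h3 := (injective_iff_map_eq_zero F).1 hinj _ h2
    rw [LinearEquiv.map_eq_zero_iff, LinearEquiv.map_eq_zero_iff, Pi.single_eq_zero_iff] at h3
    exact h3
  choose ξ a hspan using fun j ↦ exists_span_pow_eq (hq ((Fintype.equivFin ι).symm j)) _ (hX j)
  refine ⟨_, ξ, a, ?_⟩
  let χ := ψ.trans (LinearEquiv.piCongrRight fun j ↦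
    Submodule.quotEquivOfEq _ _ (hspan j))
  refine hM.unique ((HasFiber.sum fun j ↦ block_hasFiber (ξ j) (a j)).conj
    (((Module.AEval'.of F).trans (χ.restrictScalars ℂ)).symm) fun w ↦ ?_)
  rw [LinearEquiv.symm_apply_eq]
  have h := χ.map_smul X (Module.AEval'.of F (((Module.AEval'.of F).trans
    (χ.restrictScalars ℂ)).symm w))
  rw [Module.AEval'.X_smul_of] at h
  refine Eq.trans ?_ h.symm
  have h2 : χ (Module.AEval'.of F (((Module.AEval'.of F).trans
    (χ.restrictScalars ℂ)).symm w)) = w := LinearEquiv.apply_symm_apply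
      ((Module.AEval'.of F).trans (χ.restrictScalars ℂ)) w
  rw [h2]
  funext j
  obtain ⟨g, hg⟩ := Ideal.Quotient.mk_surjective (w j)
  change mulVar _ (w j) = (X : ℂ[X]) • w j
  rw [← hg]
  rfl

/-! ### Multiplication by the block of size two -/

/-- Only the first two terms of the binomial expansion survive. -/
theorem add_pow_succ_of_mul_self_eq_zero {A : Type*} [CommRing A] {s : A} (hs : s * s = 0) (t : A)
    (m : ℕ) : (s + t) ^ (m + 1) = t ^ (m + 1) + (m + 1) * (s * t ^ m) := by
  induction m with
  | zero => simp [add_comm]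
  | succ m ih =>
    rw [pow_succ, ih]
    push_cast
    linear_combination ((m : A) + 1) * t ^ m * hs

/-- Linear functionals that are nonzero on `v` and on `w` have a tensor product that is nonzero on
`v ⊗ w`. -/
theorem tmul_ne_zero {V W : Type} [AddCommGroup V] [Module ℂ V] [AddCommGroup W] [Module ℂ W]
    {v : V} {w : W} (hv : v ≠ 0) (hw : w ≠ 0) : v ⊗ₜ[ℂ] w ≠ 0 := by
  intro h
  obtain ⟨f, hf⟩ := not_forall.1 fun H ↦ hv ((Module.forall_dual_apply_eq_zero_iff ℂ v).1 H)
  obtain ⟨g, hg⟩ := not_forall.1 fun H ↦ hw ((Module.forall_dual_apply_eq_zero_iff ℂ w).1 H)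
  have := congrArg (fun x ↦ TensorProduct.lid ℂ ℂ (TensorProduct.map f g x)) h
  simp [hf, hg] at this

/-! ### Nilpotency of `x ⊗ y - ξ` when `(x - 1)^2 = 0`. -/

section tensorUnipotent

variable {A B : Type} [CommRing A] [Algebra ℂ A] [CommRing B] [Algebra ℂ B] {x : A} {y : B}
  {ξ : ℂ} {n : ℕ}

/-- `x ⊗ y - ξ = (x - 1) ⊗ y + 1 ⊗ (y - ξ)`, and the first summand squares to zero. -/
theorem tmul_sub_algebraMap_pow (hx : (x - 1) ^ 2 = 0) (m : ℕ) :
    (x ⊗ₜ[ℂ] y - algebraMap ℂ (A ⊗[ℂ] B) ξ) ^ (m + 1) =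
      1 ⊗ₜ[ℂ] ((y - algebraMap ℂ B ξ) ^ (m + 1)) +
        ((m : A ⊗[ℂ] B) + 1) * ((x - 1) ⊗ₜ[ℂ] (y * (y - algebraMap ℂ B ξ) ^ m)) := by
  have h : x ⊗ₜ[ℂ] y - algebraMap ℂ (A ⊗[ℂ] B) ξ =
      (x - 1) ⊗ₜ y + 1 ⊗ₜ (y - algebraMap ℂ B ξ) := by
    rw [TensorProduct.sub_tmul, TensorProduct.tmul_sub, Algebra.TensorProduct.algebraMap_apply,
      Algebra.algebraMap_eq_smul_one, TensorProduct.smul_tmul, ← Algebra.algebraMap_eq_smul_one]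
    abel
  have hs : ((x - 1) ⊗ₜ[ℂ] y) * ((x - 1) ⊗ₜ[ℂ] y) = 0 := by
    rw [Algebra.TensorProduct.tmul_mul_tmul, ← sq, hx, TensorProduct.zero_tmul]
  rw [h, add_pow_succ_of_mul_self_eq_zero hs, Algebra.TensorProduct.tmul_pow,
    Algebra.TensorProduct.tmul_pow, Algebra.TensorProduct.tmul_mul_tmul, one_pow, one_pow, mul_one]

theorem tmul_sub_algebraMap_pow_succ_eq_zero (hx : (x - 1) ^ 2 = 0)
    (hy : (y - algebraMap ℂ B ξ) ^ n = 0) :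
    (x ⊗ₜ[ℂ] y - algebraMap ℂ (A ⊗[ℂ] B) ξ) ^ (n + 1) = 0 := by
  rw [tmul_sub_algebraMap_pow hx, pow_succ (y - _), hy, zero_mul, mul_zero, TensorProduct.tmul_zero,
    TensorProduct.tmul_zero, mul_zero, add_zero]

/-- Since `y` acts as `ξ` on `(y - ξ)^n`, what remains is `(n + 1) ξ (x - 1) ⊗ (y - ξ)^n`. It is
nonzero because `ξ ≠ 0` and the characteristic is zero. -/
theorem tmul_sub_algebraMap_pow_ne_zero (hx : (x - 1) ^ 2 = 0) (hx' : x - 1 ≠ 0)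
    (hy : (y - algebraMap ℂ B ξ) ^ (n + 1) = 0) (hy' : (y - algebraMap ℂ B ξ) ^ n ≠ 0)
    (hξ : ξ ≠ 0) : (x ⊗ₜ[ℂ] y - algebraMap ℂ (A ⊗[ℂ] B) ξ) ^ (n + 1) ≠ 0 := by
  have h : y * (y - algebraMap ℂ B ξ) ^ n = ξ • (y - algebraMap ℂ B ξ) ^ n := by
    rw [Algebra.smul_def]
    linear_combination hy
  have hn : ((n : A ⊗[ℂ] B) + 1) = algebraMap ℂ _ ((n : ℂ) + 1) := by
    rw [map_add, map_natCast, map_one]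
  rw [tmul_sub_algebraMap_pow hx, hy, TensorProduct.tmul_zero, zero_add, h, hn,
    ← Algebra.smul_def, TensorProduct.tmul_smul]
  exact smul_ne_zero (Nat.cast_add_one_ne_zero n) (smul_ne_zero hξ (tmul_ne_zero hx' hy'))

theorem aeval_map_lmul (x : A) (y : B) (ξ : ℂ) (m : ℕ) :
    aeval (TensorProduct.map (Algebra.lmul ℂ A x) (Algebra.lmul ℂ B y)) ((X - C ξ) ^ m) =
      Algebra.lmul ℂ (A ⊗[ℂ] B) ((x ⊗ₜ y - algebraMap ℂ _ ξ) ^ m) := by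
  have h : TensorProduct.map (Algebra.lmul ℂ A x) (Algebra.lmul ℂ B y) =
      Algebra.lmul ℂ (A ⊗[ℂ] B) (x ⊗ₜ y) := 
    TensorProduct.ext' fun _ _ ↦ (Algebra.TensorProduct.tmul_mul_tmul ..).symm
  rw [h, aeval_lmul, map_pow, map_sub, aeval_X, aeval_C]

end tensorUnipotent

theorem mk_X_sub_algebraMap_pow (η : ℂ) (a m : ℕ) :
    (Ideal.Quotient.mk (Ideal.span {(X - C η) ^ a}) X - algebraMap ℂ _ η) ^ m = 0 ↔ a ≤ m := by
  have h : (Ideal.Quotient.mk (Ideal.span {(X - C η) ^ a}) X - algebraMap ℂ _ η) ^ m =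
      Ideal.Quotient.mk _ ((X - C η) ^ m) := by
    rw [map_pow, map_sub]
    rfl
  rw [h, Ideal.Quotient.eq_zero_iff_mem, Ideal.mem_span_singleton,
    pow_dvd_pow_iff (X_sub_C_ne_zero _) (not_isUnit_X_sub_C _)]

/-- The two ranks say that `F - ξ` on the product has nilpotency index exactly `n + 2`. -/
theorem classRankHom_two_mul_block (ξ : ℂˣ) (n : ℕ) :
    classRankHom p ((X - C (ξ : ℂ)) ^ (n + 2)) (block p 1 2 * block p ξ (n + 1)) = 0 ∧
      classRankHom p ((X - C (ξ : ℂ)) ^ (n + 1)) (block p 1 2 * block p ξ (n + 1)) ≠ 0 := by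
  have := cyclic_finite ((monic_X_sub_C ((1 : ℂˣ) : ℂ)).pow 2)
  have := cyclic_finite ((monic_X_sub_C (ξ : ℂ)).pow (n + 1))
  have h := (block_hasFiber (p := p) 1 2).mul (block_hasFiber ξ (n + 1))
  have h1 (m : ℕ) : ((Ideal.Quotient.mk (Ideal.span {(X - C ((1 : ℂˣ) : ℂ)) ^ 2}) X) - 1) ^ m = 0 ↔
      2 ≤ m := by
    rw [← mk_X_sub_algebraMap_pow ((1 : ℂˣ) : ℂ) 2 m]
    rfl
  rw [h.classRankHom_eq, h.classRankHom_eq, Ne, polyRank_eq_zero_iff, polyRank_eq_zero_iff, mulVar,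
    mulVar, aeval_map_lmul, aeval_map_lmul, lmul_eq_zero_iff, lmul_eq_zero_iff]
  refine ⟨tmul_sub_algebraMap_pow_succ_eq_zero ((h1 2).2 le_rfl)
    ((mk_X_sub_algebraMap_pow _ _ _).2 le_rfl),
    tmul_sub_algebraMap_pow_ne_zero ((h1 2).2 le_rfl) (fun e ↦ ?_)
      ((mk_X_sub_algebraMap_pow _ _ _).2 le_rfl) (fun e ↦ ?_) ξ.ne_zero⟩
  · exact absurd ((h1 1).1 ((pow_one _).trans e)) (by norm_num)
  · exact absurd ((mk_X_sub_algebraMap_pow _ _ _).1 e) (by omega)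

theorem eq_of_X_sub_C_pow_dvd {ξ η : ℂˣ} {a b : ℕ} (ha : a ≠ 0)
    (h : (X - C (η : ℂ)) ^ a ∣ (X - C (ξ : ℂ)) ^ b) : η = ξ ∧ a ≤ b := by
  have e : η = ξ := by
    by_contra hne
    have h1 := (isCoprime_X_sub_C_pow hne a b).isUnit_of_dvd' dvd_rfl h
    exact not_isUnit_X_sub_C _ ((isUnit_pow_iff ha).1 h1)
  subst e
  exact ⟨rfl, (pow_dvd_pow_iff (X_sub_C_ne_zero _) (not_isUnit_X_sub_C _)).1 h⟩

/-- The product of the block of size two at `1` with a block of size `n + 1` contains the block of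
size `n + 2`, and all other blocks in it are smaller. -/
theorem two_mul_block (ξ : ℂˣ) (n : ℕ) : ∃ (m : ℕ) (a : Fin m → ℕ),
    block p 1 2 * block p ξ (n + 1) = ∑ i, block p ξ (a i) ∧
      (∀ i, a i ≤ n + 2) ∧ ∃ i, a i = n + 2 := by
  obtain ⟨m, η, a, h⟩ := exists_eq_sum_block (block p 1 2 * block p ξ (n + 1))
  obtain ⟨h0, h1⟩ := classRankHom_two_mul_block (p := p) ξ n
  -- Ranks are natural numbers, so each block in the decomposition is annihilated separately.
  rw [h, map_sum, Finset.sum_eq_zero_iff] at h0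
  have key (i : Fin m) (hi : a i ≠ 0) : η i = ξ ∧ a i ≤ n + 2 :=
    eq_of_X_sub_C_pow_dvd hi ((classRankHom_block_eq_zero_iff _ _ _).1 (h0 i (Finset.mem_univ i)))
  -- A block of size `0` may carry a different eigenvalue, but it is the zero module.
  have hb (i : Fin m) : block p (η i) (a i) = block p ξ (a i) := by
    by_cases hi : a i = 0
    · rw [hi, block_zero, block_zero]
    · rw [(key i hi).1]
  refine ⟨m, a, h.trans (Finset.sum_congr rfl fun i _ ↦ hb i), fun i ↦ ?_, ?_⟩
  · by_cases hi : a i = 0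
    · omega
    · exact (key i hi).2
  · rw [h, map_sum, Ne, Finset.sum_eq_zero_iff] at h1
    push Not at h1
    obtain ⟨i, -, hi⟩ := h1
    refine ⟨i, le_antisymm ?_ ?_⟩
    · by_cases hi : a i = 0
      · omega
      · exact (key i hi).2
    -- A block of size at most `n + 1` would have rank zero for `(X - ξ)^(n+1)`, against the choice
    -- of `i`.
    · by_contra hlt
      refine hi ?_
      rw [hb, classRankHom_block_eq_zero_iff]
      exact pow_dvd_pow _ (by omega)

/-! ### The split Grothendieck ring -/

variable (p) in
/-- The class of an isomorphism class in the split Grothendieck ring. -/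
def splitHom : IsoClass (orbit p) →+* SplitGrothendieckRing (orbit p) where
  toFun c := 1 ⊗ₜ GrothendieckRing.of c
  map_zero' := by rw [map_zero, TensorProduct.tmul_zero]
  map_one' := rfl
  map_add' c c' := by rw [map_add, TensorProduct.tmul_add]
  map_mul' c c' := by
    rw [GrothendieckRing.of_mul, Algebra.TensorProduct.tmul_mul_tmul, one_mul]

theorem u_eq (ξ : ℂˣ) (a : ℕ) : u p ξ a = splitHom p (block p ξ a) := rfl

variable (p) in
/-- The linear extension of an additive function on isomorphism classes. -/
def linearExt (f : IsoClass (orbit p) →+ ℂ) : SplitGrothendieckRing (orbit p) →ₗ[ℂ] ℂ :=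
  TensorProduct.AlgebraTensorModule.lift
    ((LinearMap.toSpanSingleton ℂ (GrothendieckRing (IsoClass (orbit p)) →ₗ[ℤ] ℂ)
      (GrothendieckRing.lift f).toIntLinearMap))

theorem linearExt_splitHom (f : IsoClass (orbit p) →+ ℂ) (c : IsoClass (orbit p)) :
    linearExt p f (splitHom p c) = f c := by
  change (1 : ℂ) • GrothendieckRing.lift f (GrothendieckRing.of c) = f c
  rw [one_smul, GrothendieckRing.lift_of]

theorem u_zero (ξ : ℂˣ) : u p ξ 0 = 0 := by rw [u_eq, block_zero, map_zero]

theorem u_one_one : u p 1 1 = 1 := by rw [u_eq, block_one_one, map_one]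

theorem u_mul_u (ξ η : ℂˣ) : u p ξ 1 * u p η 1 = u p (ξ * η) 1 := by
  rw [u_eq, u_eq, u_eq, ← map_mul, block_mul_block]

/-- The classes of the modules span the split Grothendieck ring. -/
theorem span_u_eq_top :
    Submodule.span ℂ (Set.range fun x : ℂˣ × ℕ ↦ u p x.1 x.2) = ⊤ := by
  refine eq_top_iff.2 fun x _ ↦ ?_
  induction x using TensorProduct.induction_on with
  | zero => exact Submodule.zero_mem _
  | add x y hx hy => exact Submodule.add_mem _ (hx trivial) (hy trivial)
  | tmul a x =>
    have e : a ⊗ₜ[ℤ] x = a • ((1 : ℂ) ⊗ₜ[ℤ] x) := by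
      rw [TensorProduct.smul_tmul', smul_eq_mul, mul_one]
    rw [e]
    refine Submodule.smul_mem _ _ ?_
    clear e
    induction x using GrothendieckRing.induction with
    | sub x y hx hy =>
      rw [TensorProduct.tmul_sub]
      exact Submodule.sub_mem _ (hx trivial) (hy trivial)
    | of c =>
      obtain ⟨n, ξ, k, rfl⟩ := exists_eq_sum_block c
      change splitHom p _ ∈ _
      rw [map_sum]
      exact Submodule.sum_mem _ fun i _ ↦ Submodule.subset_span ⟨(ξ i, k i), rfl⟩

/-! ### The filtration by block size and multiplication by `u(1, 2)`. -/

variable (p) in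
/-- The span of the classes of the modules with eigenvalue `ξ` and size at most `n`. -/
def sizeLE (ξ : ℂˣ) (n : ℕ) : Submodule ℂ (SplitGrothendieckRing (orbit p)) :=
  Submodule.span ℂ ((fun a ↦ u p ξ a) '' Set.Iic n)

theorem u_mem_sizeLE (ξ : ℂˣ) {a n : ℕ} (h : a ≤ n) : u p ξ a ∈ sizeLE p ξ n :=
  Submodule.subset_span ⟨a, h, rfl⟩

/-- `c` counts the blocks of top size in the product; at least one exists. -/
theorem two_mul_u (ξ : ℂˣ) (n : ℕ) :
    ∃ c : ℂ, c ≠ 0 ∧ u p 1 2 * u p ξ (n + 1) - c • u p ξ (n + 2) ∈ sizeLE p ξ (n + 1) := by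
  obtain ⟨m, a, h, ha, i, hi⟩ := two_mul_block (p := p) ξ n
  refine ⟨(Finset.univ.filter fun i ↦ a i = n + 2).card, ?_, ?_⟩
  · rw [Nat.cast_ne_zero, Finset.card_ne_zero]
    exact ⟨i, by simp [hi]⟩
  · have e : u p 1 2 * u p ξ (n + 1) = ∑ i, u p ξ (a i) := by
      rw [u_eq, u_eq, ← map_mul, h, map_sum]
      rfl
    rw [e, ← Finset.sum_filter_add_sum_filter_not Finset.univ (fun i ↦ a i = n + 2),
      Finset.sum_congr rfl (g := fun _ ↦ u p ξ (n + 2))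
        (fun i hi ↦ by rw [(Finset.mem_filter.1 hi).2]), Finset.sum_const, ← Nat.cast_smul_eq_nsmul ℂ,
      add_sub_cancel_left]
    refine Submodule.sum_mem _ fun i hi ↦ u_mem_sizeLE ξ ?_
    have := ha i
    have := (Finset.mem_filter.1 hi).2
    omega

theorem two_mul_mem_sizeLE {ξ : ℂˣ} {n : ℕ} {x : SplitGrothendieckRing (orbit p)}
    (hx : x ∈ sizeLE p ξ n) : u p 1 2 * x ∈ sizeLE p ξ (n + 1) := by
  induction hx using Submodule.span_induction with
  | zero => rw [mul_zero]; exact Submodule.zero_mem _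
  | add x y _ _ hx hy => rw [mul_add]; exact Submodule.add_mem _ hx hy
  | smul c x _ hx => rw [mul_smul_comm]; exact Submodule.smul_mem _ _ hx
  | mem x hx =>
    obtain ⟨a, ha, rfl⟩ := hx
    have ha : a ≤ n := ha
    cases a with
    | zero => dsimp only; rw [u_zero, mul_zero]; exact Submodule.zero_mem _
    | succ a =>
      obtain ⟨c, -, hc⟩ := two_mul_u (p := p) ξ a
      have hle : sizeLE p ξ (a + 1) ≤ sizeLE p ξ (n + 1) :=
        Submodule.span_mono (Set.image_mono (Set.Iic_subset_Iic.2 (by omega)))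
      have := Submodule.add_mem _ (hle hc)
        (Submodule.smul_mem _ c (u_mem_sizeLE (p := p) ξ (a := a + 2) (n := n + 1) (by omega)))
      rwa [sub_add_cancel] at this

/-- Iteration of `two_mul_u`: the change from the `u(ξ, n+1)` to the products is triangular, with
nonzero diagonal entries. -/
theorem two_pow_mul_u (ξ : ℂˣ) (n : ℕ) :
    ∃ c : ℂ, c ≠ 0 ∧ u p ξ 1 * u p 1 2 ^ n - c • u p ξ (n + 1) ∈ sizeLE p ξ n := by
  induction n with
  | zero => exact ⟨1, one_ne_zero, by simp⟩
  | succ n ih =>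
    obtain ⟨c, hc, h⟩ := ih
    obtain ⟨d, hd, h'⟩ := two_mul_u (p := p) ξ n
    refine ⟨c * d, mul_ne_zero hc hd, ?_⟩
    have := Submodule.add_mem _ (two_mul_mem_sizeLE h) (Submodule.smul_mem _ c h')
    convert this using 1
    rw [mul_sub, smul_sub, mul_smul_comm, smul_smul, sub_add_sub_cancel, pow_succ]
    ring

/-- As `c ≠ 0` in `two_mul_u`, the class of size `n + 2` can be solved for in terms of smaller ones.
-/
theorem u_mem_of_generators {A : Subalgebra ℂ (SplitGrothendieckRing (orbit p))}
    (h1 : ∀ ξ, u p ξ 1 ∈ A) (h2 : u p 1 2 ∈ A) (ξ : ℂˣ) (n : ℕ) : u p ξ n ∈ A := by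
  induction n using Nat.strong_induction_on with
  | _ n ih =>
    match n with
    | 0 => rw [u_zero]; exact A.zero_mem
    | 1 => exact h1 ξ
    | n + 2 =>
      obtain ⟨c, hc, h⟩ := two_mul_u (p := p) ξ n
      have hle : sizeLE p ξ (n + 1) ≤ A.toSubmodule := by
        refine Submodule.span_le.2 ?_
        rintro _ ⟨a, ha, rfl⟩
        have ha : a ≤ n + 1 := ha
        exact ih a (by omega)
      have h3 := A.sub_mem (A.mul_mem h2 (ih (n + 1) (by omega))) (hle h)
      rw [sub_sub_cancel] at h3
      have h4 := A.smul_mem h3 c⁻¹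
      rwa [smul_smul, inv_mul_cancel₀ hc, one_smul] at h4

theorem eq_top_of_generators {A : Subalgebra ℂ (SplitGrothendieckRing (orbit p))}
    (h1 : ∀ ξ, u p ξ 1 ∈ A) (h2 : u p 1 2 ∈ A) : A = ⊤ := by
  rw [← Algebra.toSubmodule_eq_top, eq_top_iff, ← span_u_eq_top, Submodule.span_le]
  rintro _ ⟨x, rfl⟩
  exact u_mem_of_generators h1 h2 x.1 x.2

/-! ### Independence -/

variable (p) in
/-- The number of blocks with eigenvalue `ξ` and size greater than `n`. -/
def blockCount (ξ : ℂˣ) (n : ℕ) : SplitGrothendieckRing (orbit p) →ₗ[ℂ] ℂ :=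
  linearExt p (((Nat.castAddMonoidHom ℂ).comp (classRankHom p ((X - C (ξ : ℂ)) ^ n))) -
    (Nat.castAddMonoidHom ℂ).comp (classRankHom p ((X - C (ξ : ℂ)) ^ (n + 1))))

theorem blockCount_u (ξ η : ℂˣ) (n a : ℕ) : blockCount p ξ n (u p η a) =
    (classRankHom p ((X - C (ξ : ℂ)) ^ n) (block p η a) : ℂ) -
      classRankHom p ((X - C (ξ : ℂ)) ^ (n + 1)) (block p η a) :=
  linearExt_splitHom ..

theorem blockCount_u_of_ne {ξ η : ℂˣ} (h : ξ ≠ η) (n a : ℕ) :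
    blockCount p ξ n (u p η a) = 0 := by
  rw [blockCount_u, classRankHom_block_of_ne h, classRankHom_block_of_ne h, sub_self]

theorem blockCount_u_of_le (ξ : ℂˣ) {n a : ℕ} (h : a ≤ n) :
    blockCount p ξ n (u p ξ a) = 0 := by
  rw [blockCount_u, (classRankHom_block_eq_zero_iff _ ξ a).2 (pow_dvd_pow _ h),
    (classRankHom_block_eq_zero_iff _ ξ a).2 (pow_dvd_pow _ (by omega)), sub_self]

/-- `(X - ξ)^(n+1)` annihilates the block of size `n + 1`, while `(X - ξ)^n` does not. -/
theorem blockCount_u_succ_ne_zero (ξ : ℂˣ) (n : ℕ) : blockCount p ξ n (u p ξ (n + 1)) ≠ 0 := by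
  rw [blockCount_u, (classRankHom_block_eq_zero_iff _ ξ (n + 1)).2 dvd_rfl, Nat.cast_zero,
    sub_zero, Nat.cast_ne_zero, Ne, classRankHom_block_eq_zero_iff,
    pow_dvd_pow_iff (X_sub_C_ne_zero _) (not_isUnit_X_sub_C _)]
  omega

theorem blockCount_sizeLE {ξ η : ℂˣ} {n k : ℕ} (h : ξ ≠ η ∨ k ≤ n)
    {x : SplitGrothendieckRing (orbit p)} (hx : x ∈ sizeLE p η k) : blockCount p ξ n x = 0 := by
  have hle : sizeLE p η k ≤ LinearMap.ker (blockCount p ξ n) := by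
    refine Submodule.span_le.2 ?_
    rintro _ ⟨a, ha, rfl⟩
    have ha : a ≤ k := ha
    by_cases e : ξ = η
    · subst e
      exact blockCount_u_of_le ξ (ha.trans (h.resolve_left fun e ↦ e rfl))
    · exact blockCount_u_of_ne e n a
  exact hle hx

theorem u_mul_two_pow_mem_sizeLE (ξ : ℂˣ) (n : ℕ) : u p ξ 1 * u p 1 2 ^ n ∈ sizeLE p ξ (n + 1) := by
  obtain ⟨c, -, h⟩ := two_pow_mul_u (p := p) ξ n
  have := Submodule.add_mem _
    (Submodule.span_mono (Set.image_mono (Set.Iic_subset_Iic.2 n.le_succ)) h)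
    (Submodule.smul_mem _ c (u_mem_sizeLE (p := p) ξ (le_refl (n + 1))))
  rwa [sub_add_cancel] at this

theorem blockCount_mul_two_pow_ne_zero (ξ : ℂˣ) (n : ℕ) :
    blockCount p ξ n (u p ξ 1 * u p 1 2 ^ n) ≠ 0 := by
  obtain ⟨c, hc, h⟩ := two_pow_mul_u (p := p) ξ n
  have := blockCount_sizeLE (ξ := ξ) (Or.inr le_rfl) h
  rw [map_sub, sub_eq_zero] at this
  rw [this, map_smul, smul_eq_mul]
  exact mul_ne_zero hc (blockCount_u_succ_ne_zero ξ n)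

/-! ### The isomorphism -/

variable (p) in
/-- The homomorphism from the group algebra to the split Grothendieck ring. -/
def groupAlgebraHom : MonoidAlgebra ℂ ℂˣ →ₐ[ℂ] SplitGrothendieckRing (orbit p) :=
  MonoidAlgebra.lift ℂ _ ℂˣ
    { toFun := fun ξ ↦ u p ξ 1
      map_one' := u_one_one
      map_mul' := fun ξ η ↦ (u_mul_u ξ η).symm }

theorem groupAlgebraHom_single (ξ : ℂˣ) (c : ℂ) :
    groupAlgebraHom p (MonoidAlgebra.single ξ c) = c • u p ξ 1 :=
  MonoidAlgebra.lift_single ..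

variable (p) in
/-- The homomorphism from the polynomial ring over the group algebra to the split Grothendieck
ring. -/
def polyHom : (MonoidAlgebra ℂ ℂˣ)[X] →ₐ[ℂ] SplitGrothendieckRing (orbit p) :=
  { eval₂RingHom (groupAlgebraHom p : MonoidAlgebra ℂ ℂˣ →+* _) (u p 1 2) with
    commutes' := fun c ↦ by
      change eval₂ _ _ (C (algebraMap ℂ (MonoidAlgebra ℂ ℂˣ) c)) = _
      rw [eval₂_C]
      exact (groupAlgebraHom p).commutes c }

theorem polyHom_C (a : MonoidAlgebra ℂ ℂˣ) : polyHom p (C a) = groupAlgebraHom p a :=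
  eval₂_C _ _

theorem polyHom_C_single (ξ : ℂˣ) : polyHom p (C (MonoidAlgebra.single ξ 1)) = u p ξ 1 := by
  rw [polyHom_C, groupAlgebraHom_single, one_smul]

theorem polyHom_X : polyHom p X = u p 1 2 := eval₂_X _ _

theorem polyHom_surjective : Function.Surjective (polyHom p) := by
  rw [← AlgHom.range_eq_top]
  exact eq_top_of_generators (fun ξ ↦ ⟨_, polyHom_C_single ξ⟩) ⟨_, polyHom_X⟩

/-- The functional sees neither lower powers of `u(1, 2)` nor group elements other than `ξ`, so it
isolates one coefficient. -/
theorem blockCount_groupAlgebraHom_mul {ξ : ℂˣ} {n k : ℕ} (h : k ≤ n) (a : MonoidAlgebra ℂ ℂˣ) :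
    blockCount p ξ n (groupAlgebraHom p a * u p 1 2 ^ k) =
      if k = n then a.coeff ξ * blockCount p ξ n (u p ξ 1 * u p 1 2 ^ n) else 0 := by
  induction a using MonoidAlgebra.induction_linear with
  | zero => simp
  | add a b ha hb =>
    rw [map_add, add_mul, map_add, ha, hb]
    split_ifs
    · rw [← add_mul]; rfl
    · rw [add_zero]
  | single η c =>
    rw [groupAlgebraHom_single, smul_mul_assoc, map_smul, smul_eq_mul]
    split_ifs with e
    · subst e
      by_cases e : ξ = η
      · subst e
        simp
      · rw [blockCount_sizeLE (Or.inl e) (u_mul_two_pow_mem_sizeLE η k), mul_zero,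
          MonoidAlgebra.coeff_single, Finsupp.single_apply, if_neg (Ne.symm e), zero_mul]
    · rw [blockCount_sizeLE (Or.inr (by omega)) (u_mul_two_pow_mem_sizeLE η k), mul_zero]

theorem polyHom_injective : Function.Injective (polyHom p) := by
  refine (injective_iff_map_eq_zero _).2 fun P hP ↦ leadingCoeff_eq_zero.1 ?_
  ext ξ
  have h : polyHom p P = ∑ k ∈ Finset.range (P.natDegree + 1),
      groupAlgebraHom p (P.coeff k) * u p 1 2 ^ k := eval₂_eq_sum_range _ _
  -- With the index equal to the degree only the top term survives, so the coefficient of `ξ` in the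
  -- leading coefficient is zero.
  have h2 := congrArg (blockCount p ξ P.natDegree) (h.symm.trans hP)
  rw [map_sum, map_zero, Finset.sum_congr rfl fun k hk ↦ blockCount_groupAlgebraHom_mul
    (Nat.lt_succ_iff.1 (Finset.mem_range.1 hk)) _, Finset.sum_ite_eq',
    if_pos (Finset.self_mem_range_succ _)] at h2
  exact (mul_eq_zero.1 h2).resolve_right (blockCount_mul_two_pow_ne_zero ξ _)

variable (p) in
/-- The isomorphism from the polynomial ring over the group algebra to the split Grothendieck
ring. -/
def polyEquiv : (MonoidAlgebra ℂ ℂˣ)[X] ≃ₐ[ℂ] SplitGrothendieckRing (orbit p) :=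
  AlgEquiv.ofBijective (polyHom p) ⟨polyHom_injective, polyHom_surjective⟩

/-! ### The presentation -/

/-- The ideal of relations between the generators. -/
def relations : Ideal (MvPolynomial (ℂˣ ⊕ Unit) ℂ) :=
  Ideal.span
    (Set.range (fun x : ℂˣ × ℂˣ ↦
      (MvPolynomial.X (.inl x.1) * MvPolynomial.X (.inl x.2) -
        MvPolynomial.X (.inl (x.1 * x.2)) : MvPolynomial (ℂˣ ⊕ Unit) ℂ)) ∪
    {MvPolynomial.X (.inl 1) - 1})

/-- The homomorphism from the group algebra to the presented algebra. -/
def groupAlgebraToPresented :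
    MonoidAlgebra ℂ ℂˣ →ₐ[ℂ] MvPolynomial (ℂˣ ⊕ Unit) ℂ ⧸ relations :=
  MonoidAlgebra.lift ℂ _ ℂˣ
    { toFun := fun ξ ↦ Ideal.Quotient.mk _ (MvPolynomial.X (.inl ξ))
      map_one' := (Ideal.Quotient.eq (I := relations)).2 (Ideal.subset_span (Or.inr rfl))
      map_mul' := fun ξ η ↦ by
        rw [← map_mul]
        exact ((Ideal.Quotient.eq (I := relations)).2
          (Ideal.subset_span (Or.inl ⟨(ξ, η), rfl⟩))).symm }

/-- The homomorphism from the polynomial ring over the group algebra to the presented algebra. -/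
def toPresented : (MonoidAlgebra ℂ ℂˣ)[X] →+* MvPolynomial (ℂˣ ⊕ Unit) ℂ ⧸ relations :=
  eval₂RingHom (groupAlgebraToPresented : MonoidAlgebra ℂ ℂˣ →+* _)
    (Ideal.Quotient.mk _ (MvPolynomial.X (.inr ())))

/-- The values of the generators in the polynomial ring over the group algebra. -/
def polyGen : ℂˣ ⊕ Unit → (MonoidAlgebra ℂ ℂˣ)[X] :=
  Sum.elim (fun ξ ↦ C (MonoidAlgebra.single ξ 1)) fun _ ↦ X

/-- Any relation that holds in `ℂ[ℂ^×][x]` already lies in `relations`. -/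
theorem toPresented_aeval_polyGen (P : MvPolynomial (ℂˣ ⊕ Unit) ℂ) :
    toPresented (MvPolynomial.aeval polyGen P) = Ideal.Quotient.mk relations P := by
  have h : toPresented.comp (MvPolynomial.aeval (R := ℂ) polyGen : _ →+* _) =
      Ideal.Quotient.mk relations := by
    refine MvPolynomial.ringHom_ext (fun c ↦ ?_) fun i ↦ ?_
    · simp only [RingHom.comp_apply, RingHom.coe_coe, MvPolynomial.aeval_C]
      refine (eval₂_C _ _).trans (AlgHom.commutes groupAlgebraToPresented c)
    · simp only [RingHom.comp_apply, RingHom.coe_coe, MvPolynomial.aeval_X]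
      cases i with
      | inl ξ =>
        refine (eval₂_C _ _).trans ?_
        refine (MonoidAlgebra.lift_single ..).trans (one_smul _ _)
      | inr _ => exact eval₂_X _ _
  exact RingHom.congr_fun h P

theorem ker_aeval_eq_relations :
    RingHom.ker (MvPolynomial.aeval (R := ℂ)
      (Sum.elim (fun ξ : ℂˣ ↦ u p ξ 1) fun _ : Unit ↦ u p 1 2)) = relations := by
  apply le_antisymm
  · intro P hP
    have h : (polyHom p).comp (MvPolynomial.aeval polyGen) = MvPolynomial.aeval (R := ℂ)
        (Sum.elim (fun ξ : ℂˣ ↦ u p ξ 1) fun _ : Unit ↦ u p 1 2) := by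
      refine MvPolynomial.algHom_ext fun i ↦ ?_
      rw [AlgHom.comp_apply, MvPolynomial.aeval_X, MvPolynomial.aeval_X]
      cases i with
      | inl ξ => exact polyHom_C_single ξ
      | inr _ => exact polyHom_X
    rw [RingHom.mem_ker, ← h, AlgHom.comp_apply] at hP
    -- Injectivity pulls the relation `P` back to the polynomial ring over the group algebra, where
    -- `toPresented` applies.
    have h0 := polyHom_injective (hP.trans (map_zero _).symm)
    rw [← Ideal.Quotient.eq_zero_iff_mem, ← toPresented_aeval_polyGen, h0, map_zero]
  · refine Ideal.span_le.2 ?_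
    rintro _ (⟨⟨ξ, η⟩, rfl⟩ | rfl)
    · simp [RingHom.mem_ker, u_mul_u]
    · simp [RingHom.mem_ker, u_one_one]

end SkewLaurent

end

theorem theorem5p5 (p : ℕ) [NeZero p] :
    (∀ ξ η : ℂˣ,
      SkewLaurent.u p ξ 1 * SkewLaurent.u p η 1 = SkewLaurent.u p (ξ * η) 1) ∧
    SkewLaurent.u p 1 1 = 1 ∧
    Algebra.adjoin ℂ (Set.range (fun ξ : ℂˣ ↦ SkewLaurent.u p ξ 1) ∪ {SkewLaurent.u p 1 2}) = ⊤ ∧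
    -- the kernel of the map from the free commutative algebra on the generators
    RingHom.ker (MvPolynomial.aeval (R := ℂ)
        (Sum.elim (fun ξ : ℂˣ ↦ SkewLaurent.u p ξ 1) fun _ : Unit ↦ SkewLaurent.u p 1 2)) =
      Ideal.span
        (Set.range (fun x : ℂˣ × ℂˣ ↦
          (MvPolynomial.X (.inl x.1) * MvPolynomial.X (.inl x.2) -
            MvPolynomial.X (.inl (x.1 * x.2)) : MvPolynomial (ℂˣ ⊕ Unit) ℂ)) ∪
        {MvPolynomial.X (.inl 1) - 1}) ∧
    ∃ Φ : Polynomial (MonoidAlgebra ℂ ℂˣ) ≃ₐ[ℂ]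
        SplitGrothendieckRing (SkewLaurent.orbit p),
      (∀ ξ : ℂˣ, Φ (Polynomial.C (MonoidAlgebra.single ξ 1)) = SkewLaurent.u p ξ 1) ∧
      Φ Polynomial.X = SkewLaurent.u p 1 2 :=
  ⟨SkewLaurent.u_mul_u, SkewLaurent.u_one_one,
    SkewLaurent.eq_top_of_generators
      (fun ξ ↦ Algebra.subset_adjoin (Or.inl ⟨ξ, rfl⟩)) (Algebra.subset_adjoin (Or.inr rfl)),
    SkewLaurent.ker_aeval_eq_relations,
    SkewLaurent.polyEquiv p, SkewLaurent.polyHom_C_single, SkewLaurent.polyHom_X⟩
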